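/- All codes are binary. For a finite set of $n$ qubits let $\mathcal E_n=\{\pm X(\mathbf a)Z(\mathbf b):\mathbf a,\mathbf b\in\mathbb F_2^n\}$ be the Pauli group on $(\mathbb C^2)^{\otimes n}$, where $X(\mathbf a)|\mathbf j\rangle=|\mathbf j+\mathbf a\rangle$ and $Z(\mathbf b)|\mathbf j\rangle=(-1)^{\mathbf b\cdot\mathbf j}|\mathbf j\rangle$. Let $\tau(\pm X(\mathbf a)Z(\mathbf b))=(\mathbf a|\mathbf b)$, and let $\mathrm{wt}(\mathbf a|\mathbf b)$ be the number of $i$ with $(a_i,b_i)\ne(0,0)$. For a subgroup $\mathcal S\le\mathcal E_n$ let $\mathcal N(\mathcal S)$ be the group of all elements of $\mathcal E_n$ that commute with every element of $\mathcal S$, and let $\mathcal S_I=\mathcal S\cap\mathcal N(\mathcal S)$. * An Abelian subgroup $\mathcal S^b\le\mathcal E_m$ with $-I\notin\mathcal S^b$ and $|\mathcal S^b|=2^{m-k}$ *stabilizes* an $[[m,k,d]]$ code if the states fixed by $\mathcal S^b$ form a space of dimension $2^k$ and $d=\min\{\mathrm{wt}(v): v\in\tau(\mathcal N(\mathcal S^b))\setminus\tau(\mathcal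 S^b)\}$. * A subgroup $\mathcal S\le\mathcal E_n$ *EA-stabilizes* an $[[n,k,d;c]]$ entanglement-assisted code if $|\tau(\mathcal S_I)|=2^{l}$ and $|\tau(\mathcal S)|=2^{l+2c}$ with $k=n-c-l$; if there is an Abelian subgroup $\tilde{\mathcal S}\le\mathcal E_{n+c}$ with $-I\notin\tilde{\mathcal S}$ such that deleting the last $c$ qubits maps $\tau(\tilde{\mathcal S})$ bijectively onto $\tau(\mathcal S)$, and the states fixed by $\tilde{\mathcal S}$ form a space of dimension $2^k$; and if $d=\min\{\mathrm{wt}(v):v\in\tau(\mathcal N(\mathcal S))\setminus\tau(\mathcal S_I)\}$. * An *EAQECC-Ne* (entanglement-assisted code with noisy ebits) $[[n,k,d;c]]+[[m,k_b,d_b]]$ is a pair $(\mathcal S,\mathcal S^b)$ of subgroups $\mathcal S\le\mathcal E_n$, $\mathcal S^b\le\mathcal E_m$ such that $\mathcal S$ EA-stabilizes an $[[n,k,d;c]]$ code, $\mathcal S^b$ stabilizes an $[[m,k_b,d_b]]$ code, and $k_b\ge c$. **Proposition 4.2.** (1) For every $m\ge2$ there are EAQECCs-Ne $[[4m,1,2m+1;1]]+[[5,1,3]]$,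 $[[4m+1,1,2m+3;4]]+[[10,4,3]]$, $[[4m+2,1,2m+3;3]]+[[8,3,3]]$ and $[[4m+3,1,2m+3;2]]+[[8,2,3]]$. (2) There are EAQECCs-Ne $[[7,2,5;5]]+[[11,5,3]]$, $[[8,2,5;4]]+[[10,4,3]]$, $[[9,2,5;3]]+[[8,3,3]]$, $[[10,2,6;4]]+[[10,4,3]]$, $[[9,3,6;6]]+[[12,6,3]]$, $[[13,3,9;10]]+[[16,10,3]]$ and $[[12,4,7;8]]+[[14,8,3]]$. -/

import Mathlib

namespace QubitCode

section PauliGroup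

variable {ι : Type} [Fintype ι] [DecidableEq ι]

/-- Operators on the state space `(ℂ²)^{⊗ι}` of a register of qubits labelled by `ι`, written as
matrices in the computational basis `|j⟩`, `j ∈ 𝔽₂^ι`. -/
abbrev Operator (ι : Type) : Type := Matrix (ι → ZMod 2) (ι → ZMod 2) ℂ

/-- `X(a) = ⨂ₜ X(aₜ)`, that is `X(a)|j⟩ = |j + a⟩`. -/
def opX (a : ι → ZMod 2) : Operator ι :=
  Matrix.of fun i j => if i = j + a then 1 else 0

/-- `Z(b) = ⨂ₜ Z(bₜ)`, that is `Z(b)|j⟩ = (-1)^{b·j}|j⟩`. -/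
def opZ (b : ι → ZMod 2) : Operator ι :=
  Matrix.diagonal fun j => (-1 : ℂ) ^ (b ⬝ᵥ j).val

/-- `ω^s X(a) Z(b)` with `ω = -1`. -/
def pauliOp (s : ZMod 2) (a b : ι → ZMod 2) : Operator ι :=
  (-1 : ℂ) ^ s.val • (opX a * opZ b)

theorem neg_one_pow_val_add (s t : ZMod 2) :
    (-1 : ℂ) ^ (s + t).val = (-1 : ℂ) ^ s.val * (-1 : ℂ) ^ t.val := by
  rw [ZMod.val_add, ← neg_one_pow_eq_pow_mod_two, pow_add]

theorem pauliOp_apply (s : ZMod 2) (a b : ι → ZMod 2) (i j : ι → ZMod 2) :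
    pauliOp s a b i j = if i = j + a then (-1 : ℂ) ^ (s + b ⬝ᵥ j).val else 0 := by
  simp only [pauliOp, opX, opZ, Matrix.smul_apply, Matrix.mul_diagonal, Matrix.of_apply,
    smul_eq_mul, neg_one_pow_val_add]
  split_ifs <;> simp

theorem pauliOp_mul (s s' : ZMod 2) (a b a' b' : ι → ZMod 2) :
    pauliOp s a b * pauliOp s' a' b' = pauliOp (s + s' + b ⬝ᵥ a') (a + a') (b + b') := by
  ext i j
  rw [Matrix.mul_apply, Finset.sum_eq_single (j + a')]
  · simp only [pauliOp_apply, if_true]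
    have h : j + a' + a = j + (a + a') := by abel
    rw [h]
    split_ifs
    · rw [← neg_one_pow_val_add, dotProduct_add, add_dotProduct]
      congr 2
      ring
    · simp
  · intro t _ ht
    simp [pauliOp_apply, ht]
  · simp

theorem pauliOp_zero : pauliOp (0 : ZMod 2) (0 : ι → ZMod 2) 0 = 1 := by
  ext i j
  simp [pauliOp_apply, Matrix.one_apply]

theorem pauliOp_mul_inv (s : ZMod 2) (a b : ι → ZMod 2) :
    pauliOp s a b * pauliOp (s + b ⬝ᵥ a) a b = 1 := by
  have ha : a + a = 0 := funext fun i => CharTwo.add_self_eq_zero (a i)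
  have hb : b + b = 0 := funext fun i => CharTwo.add_self_eq_zero (b i)
  rw [pauliOp_mul, ha, hb, ← pauliOp_zero]
  congr 1
  have h : s + (s + b ⬝ᵥ a) + b ⬝ᵥ a = (s + s) + (b ⬝ᵥ a + b ⬝ᵥ a) := by ring
  rw [h, CharTwo.add_self_eq_zero, CharTwo.add_self_eq_zero, add_zero]

theorem pauliOp_inv_mul (s : ZMod 2) (a b : ι → ZMod 2) :
    pauliOp (s + b ⬝ᵥ a) a b * pauliOp s a b = 1 := by
  have h := pauliOp_mul_inv (s + b ⬝ᵥ a) a b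
  rwa [add_assoc, CharTwo.add_self_eq_zero, add_zero] at h

/-- `ω^s X(a) Z(b)` as an invertible operator. -/
def pauliUnit (s : ZMod 2) (a b : ι → ZMod 2) : (Operator ι)ˣ where
  val := pauliOp s a b
  inv := pauliOp (s + b ⬝ᵥ a) a b
  val_inv := pauliOp_mul_inv s a b
  inv_val := pauliOp_inv_mul s a b

/-- The Pauli group `ℰ = {ω^s X(a) Z(b)}`, `ω = -1`, of the register `ι`. -/
def PauliGroup (ι : Type) [Fintype ι] [DecidableEq ι] : Subgroup (Operator ι)ˣ where
  carrier := {g | ∃ s a b, g = pauliUnit s a b}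
  one_mem' := ⟨0, 0, 0, Units.ext pauliOp_zero.symm⟩
  mul_mem' := by
    rintro _ _ ⟨s, a, b, rfl⟩ ⟨s', a', b', rfl⟩
    exact ⟨_, _, _, Units.ext (pauliOp_mul s s' a b a' b')⟩
  inv_mem' := by
    rintro _ ⟨s, a, b, rfl⟩
    exact ⟨s + b ⬝ᵥ a, a, b, Units.ext rfl⟩

/-- `ω^s X(a) Z(b)` as an element of the Pauli group; `pauli 1 0 0` is `ωI = -I`. -/
def pauli (s : ZMod 2) (a b : ι → ZMod 2) : PauliGroup ι :=
  ⟨pauliUnit s a b, s, a, b, rfl⟩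

/-- The image `τ(H) ⊆ 𝔽₂^ι × 𝔽₂^ι` of a subgroup `H` under `ω^s X(a) Z(b) ↦ (a|b)`: it is `H`
up to phases. -/
def tau (H : Subgroup (PauliGroup ι)) : Set ((ι → ZMod 2) × (ι → ZMod 2)) :=
  {v | ∃ s, pauli s v.1 v.2 ∈ H}

/-- The weight of `ω^s X(a) Z(b)`: the number of qubits on which it acts nontrivially. -/
def weight (v : (ι → ZMod 2) × (ι → ZMod 2)) : ℕ :=
  (Finset.univ.filter fun i => v.1 i ≠ 0 ∨ v.2 i ≠ 0).card

/-- The space of states fixed by every operator in `H`. -/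
def codeSpace (H : Subgroup (PauliGroup ι)) : Submodule ℂ ((ι → ZMod 2) → ℂ) where
  carrier := {ψ | ∀ g ∈ H, (((g : (Operator ι)ˣ) : Operator ι)).mulVec ψ = ψ}
  zero_mem' := fun _ _ => Matrix.mulVec_zero _
  add_mem' := fun hψ hφ g hg => by rw [Matrix.mulVec_add, hψ g hg, hφ g hg]
  smul_mem' := fun z ψ hψ g hg => by rw [Matrix.mulVec_smul, hψ g hg]

/-- `N(S)`: the Pauli operators that commute with every element of `S` (for an Abelian `S` without
`ωI` this is the group-theoretic normalizer of `S` in the Pauli group). -/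
def normalizer (S : Subgroup (PauliGroup ι)) : Subgroup (PauliGroup ι) :=
  Subgroup.centralizer (S : Set (PauliGroup ι))

/-- `S_I = S ∩ N(S)`, the isotropic part of `S`. -/
def isotropicPart (S : Subgroup (PauliGroup ι)) : Subgroup (PauliGroup ι) :=
  S ⊓ normalizer S

/-- `S` is Abelian and does not contain `ωI`. -/
structure IsStabilizer (S : Subgroup (PauliGroup ι)) : Prop where
  comm : ∀ g ∈ S, ∀ h ∈ S, g * h = h * g
  phase_not_mem : pauli 1 0 0 ∉ S

end PauliGroup

/-- `S` stabilizes an `[[m, k, d]]` quantum code: `S` is an Abelian subgroup of order `2^(m-k)`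
without `ωI`, the states fixed by `S` form a `2^k`-dimensional space, and
`d = min {wt(g) | g ∈ N(S) ∖ S}`, where phases are disregarded. -/
structure Stabilizes {m : ℕ} (S : Subgroup (PauliGroup (Fin m))) (k d : ℕ) : Prop where
  isStabilizer : IsStabilizer S
  card_eq : ∃ r, Nat.card S = 2 ^ r ∧ m = k + r
  finrank_codeSpace : Module.finrank ℂ (codeSpace S) = 2 ^ k
  distance : IsLeast (weight '' (tau (normalizer S) \ tau S)) d

/-- The part of an operator on the `n + c` qubits of Alice and Bob that acts on Alice's `n`. -/
def restrictAlice {n c : ℕ} (v : (Fin n ⊕ Fin c → ZMod 2) × (Fin n ⊕ Fin c → ZMod 2)) :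
    (Fin n → ZMod 2) × (Fin n → ZMod 2) :=
  (v.1 ∘ Sum.inl, v.2 ∘ Sum.inl)

/-- `T` extends the (possibly non-Abelian) subgroup `S` to an Abelian one: `T` is an Abelian
subgroup of the Pauli group on Alice's `n` qubits and Bob's `c` halves of ebits, without `ωI`, and
deleting Bob's part maps `T` bijectively to `S` (up to phases). -/
structure IsAbelianExtension {n c : ℕ} (S : Subgroup (PauliGroup (Fin n)))
    (T : Subgroup (PauliGroup (Fin n ⊕ Fin c))) : Prop where
  isStabilizer : IsStabilizer T
  bijOn : Set.BijOn restrictAlice (tau T) (tau S)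

/-- `S` EA-stabilizes an `[[n, k, d; c]]` entanglement-assisted quantum code. Up to phases, the
isotropic part `S_I` of `S` has size `2^l` and `S` has size `2^(l+2c)`, so that a complement `S_E`
of `S_I` in `S` is an entanglement subgroup of size `2^(2c)`; `k = n - c - l`; `S` has an Abelian
extension to `n + c` qubits whose fixed states form a `2^k`-dimensional space (by the sizes just
given, its elements act on Bob's side as the full Pauli group of `c` qubits, so the `c` ebits are
maximally entangled); and `d = min {wt(g) | g ∈ N(S) ∖ S_I}`, where phases are disregarded. -/
structure EAStabilizes {n : ℕ} (S : Subgroup (PauliGroup (Fin n))) (k d c : ℕ) : Prop where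
  card_eq : ∃ l, (tau (isotropicPart S)).ncard = 2 ^ l ∧ (tau S).ncard = 2 ^ (l + 2 * c) ∧
    n = k + c + l
  extension : ∃ T : Subgroup (PauliGroup (Fin n ⊕ Fin c)), IsAbelianExtension S T ∧
    Module.finrank ℂ (codeSpace T) = 2 ^ k
  distance : IsLeast (weight '' (tau (normalizer S) \ tau (isotropicPart S))) d

/-- `(S, Sb)` is a matching pair that describes a combination EAQECC with noisy ebits
`[[n, k, d; c]] + [[m, kb, db]]`: `S` EA-stabilizes the sender's `[[n, k, d; c]]` code, and `Sb`
stabilizes an `[[m, kb, db]]` code that can hold the receiver's `c` halves of ebits. -/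
structure IsMatchingPair {n m : ℕ} (S : Subgroup (PauliGroup (Fin n)))
    (Sb : Subgroup (PauliGroup (Fin m))) (k d c kb db : ℕ) : Prop where
  sender : EAStabilizes S k d c
  receiver : Stabilizes Sb kb db
  le : c ≤ kb

/-- There is an EAQECC-Ne `[[n, k, d; c]] + [[m, kb, db]]`. -/
def ExistsEAQECCNe (n k d c m kb db : ℕ) : Prop :=
  ∃ (S : Subgroup (PauliGroup (Fin n))) (Sb : Subgroup (PauliGroup (Fin m))),
    IsMatchingPair S Sb k d c kb db

end QubitCode

/-! Up to sign, Pauli operators are vectors of the symplectic space 𝔽₂^n × 𝔽₂^n, and commutation is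
orthogonality. A code is therefore described by a symplectic basis split into three kinds of
hyperbolic pairs: for pairs labelled `L` only the `e` vector is in the code group, for pairs
labelled `C` both vectors are, and for pairs labelled `K` neither is. The `e` vectors of `L`
generate the isotropic part, the `C` pairs need one ebit each, and the `K` pairs are the logical
operators. The sizes 2^l and 2^(l+2c) and the normalizer can be read off from the basis, so only the
distance needs a computation.

Two points connect labels with operators. Signs: the Pauli group has only the phases ±1, so a label
lifts to an operator squaring to I exactly when it has an even number of `Y`s. On a totally singular
subspace the group cocycle is alternating, hence a coboundary, and the subspace lifts to a group
without -I (`IsTotallySingular.exists_isStabilizer`). Dimension: the average over such a group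
projects onto the code space, and only the identity has nonzero trace
(`IsStabilizer.card_mul_finrank_codeSpace`).

The infinite families come from one small code each, by replacing four qubits by repetition codes of
length m. A logical operator of weight w with h bit flips on these qubits then costs w + (m-1)h =
(w+h) + (m-2)h. One logical operator minimizes both w+h and h, so a finite check settles all m ≥ 2
(`exists_eaStabilizes_of_check`). The sporadic senders use the same check with no qubit replaced.
The receivers are pure codes, for which it suffices that every nonzero error on two qubits has a
nonzero syndrome (`exists_stabilizes_of_check`). -/

namespace QubitCode

/-! ### Phase space, its cocycle and its symplectic form. -/

section PhaseSpace

variable {ι : Type} [Fintype ι]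

/-- The phase space `𝔽₂^ι × 𝔽₂^ι`, which labels Pauli operators up to sign. -/
abbrev PhaseSpace (ι : Type) : Type := (ι → ZMod 2) × (ι → ZMod 2)

/-- The cocycle of the Pauli group: `(ω^s v)(ω^t w) = ω^(s + t + v.2·w.1) (v + w)`. -/
def cocycle : LinearMap.BilinForm (ZMod 2) (PhaseSpace ι) :=
  LinearMap.mk₂ (ZMod 2) (fun v w => v.2 ⬝ᵥ w.1)
    (fun _ _ _ => add_dotProduct _ _ _) (fun _ _ _ => smul_dotProduct _ _ _)
    (fun _ _ _ => dotProduct_add _ _ _) (fun _ _ _ => dotProduct_smul _ _ _)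

/-- The symplectic form on phase space, which detects commutation of Pauli operators. -/
def symp : LinearMap.BilinForm (ZMod 2) (PhaseSpace ι) :=
  LinearMap.mk₂ (ZMod 2) (fun v w => v.1 ⬝ᵥ w.2 + v.2 ⬝ᵥ w.1)
    (fun _ _ _ => by simp only [Prod.fst_add, Prod.snd_add, add_dotProduct]; ring)
    (fun _ _ _ => by simp only [Prod.smul_fst, Prod.smul_snd, smul_dotProduct, smul_add])
    (fun _ _ _ => by simp only [Prod.fst_add, Prod.snd_add, dotProduct_add]; ring)
    (fun _ _ _ => by simp only [Prod.smul_fst, Prod.smul_snd, dotProduct_smul, smul_add])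

theorem cocycle_apply (v w : PhaseSpace ι) : cocycle v w = v.2 ⬝ᵥ w.1 := rfl

theorem symp_apply (v w : PhaseSpace ι) : symp v w = v.1 ⬝ᵥ w.2 + v.2 ⬝ᵥ w.1 := rfl

theorem symp_eq_cocycle (v w : PhaseSpace ι) : symp v w = cocycle v w + cocycle w v := by
  rw [symp_apply, cocycle_apply, cocycle_apply, dotProduct_comm v.1, add_comm]

theorem symp_comm (v w : PhaseSpace ι) : symp v w = symp w v := by
  rw [symp_eq_cocycle, symp_eq_cocycle, add_comm]

variable [DecidableEq ι]

theorem zmod_two_eq_one_of_ne_zero {x : ZMod 2} (h : x ≠ 0) : x = 1 := by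
  revert x; decide

/-! ### The Pauli group -/

theorem exists_eq_pauli (g : PauliGroup ι) : ∃ s a b, g = pauli s a b := by
  obtain ⟨_, s, a, b, rfl⟩ := g
  exact ⟨s, a, b, rfl⟩

theorem coe_pauli (s : ZMod 2) (a b : ι → ZMod 2) :
    ((pauli s a b : (Operator ι)ˣ) : Operator ι) = pauliOp s a b := rfl

theorem pauli_mul (s s' : ZMod 2) (a b a' b' : ι → ZMod 2) :
    pauli s a b * pauli s' a' b' = pauli (s + s' + b ⬝ᵥ a') (a + a') (b + b') :=
  Subtype.ext (Units.ext (pauliOp_mul s s' a b a' b'))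

theorem pauli_zero : pauli (0 : ZMod 2) (0 : ι → ZMod 2) 0 = 1 :=
  Subtype.ext (Units.ext pauliOp_zero)

theorem pauli_inv (s : ZMod 2) (a b : ι → ZMod 2) :
    (pauli s a b)⁻¹ = pauli (s + b ⬝ᵥ a) a b :=
  Subtype.ext (Units.ext rfl)

theorem neg_one_pow_val_injective {s t : ZMod 2} (h : (-1 : ℂ) ^ s.val = (-1 : ℂ) ^ t.val) :
    s = t := by
  have key : ∀ u : ZMod 2, u = 0 ∨ u = 1 := by decide
  rcases key s with rfl | rfl <;> rcases key t with rfl | rfl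
  · rfl
  · simp [ZMod.val_one] at h
    norm_num at h
  · simp [ZMod.val_one] at h
    norm_num at h
  · rfl

/-- Column 0 has its nonzero entry in row `a`, and the signs of the entries `(j + a, j)` give the
affine function `s + b ⬝ᵥ j`, which determines `s` and `b`. -/
theorem pauli_injective {s s' : ZMod 2} {a a' b b' : ι → ZMod 2}
    (h : pauli s a b = pauli s' a' b') : s = s' ∧ a = a' ∧ b = b' := by
  have h1 : pauliOp s a b = pauliOp s' a' b' := by rw [← coe_pauli, h, coe_pauli]
  have h2 : ∀ i j, pauliOp s a b i j = pauliOp s' a' b' i j := fun i j => by rw [h1]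
  have ha : a = a' := by
    have h3 := h2 a 0
    simp only [pauliOp_apply, zero_add, if_true] at h3
    by_contra hne
    rw [if_neg hne] at h3
    exact pow_ne_zero _ (by norm_num) h3
  subst ha
  have h3 : ∀ j, s + b ⬝ᵥ j = s' + b' ⬝ᵥ j := fun j => by
    have h4 := h2 (j + a) j
    simp only [pauliOp_apply, if_true] at h4
    exact neg_one_pow_val_injective h4
  have hs : s = s' := by simpa using h3 0
  subst hs
  refine ⟨rfl, rfl, funext fun i => ?_⟩
  simpa using h3 (Pi.single i 1)

theorem pauli_commute_iff (s s' : ZMod 2) (v w : PhaseSpace ι) :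
    pauli s v.1 v.2 * pauli s' w.1 w.2 = pauli s' w.1 w.2 * pauli s v.1 v.2 ↔ symp v w = 0 := by
  rw [pauli_mul, pauli_mul, symp_eq_cocycle, cocycle_apply, cocycle_apply,
    CharTwo.add_eq_zero]
  constructor
  · intro h
    have h1 := (pauli_injective h).1
    rw [add_comm s' s] at h1
    exact add_left_cancel h1
  · intro h
    rw [h, add_comm s s', add_comm v.1, add_comm v.2]

/-- All Pauli operators, with either sign, whose label lies in `C`. -/
def fullPreimage (C : Submodule (ZMod 2) (PhaseSpace ι)) : Subgroup (PauliGroup ι) where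
  carrier := {g | ∃ s, ∃ v ∈ C, g = pauli s v.1 v.2}
  one_mem' := ⟨0, 0, C.zero_mem, pauli_zero.symm⟩
  mul_mem' := by
    rintro _ _ ⟨s, v, hv, rfl⟩ ⟨s', w, hw, rfl⟩
    exact ⟨_, v + w, C.add_mem hv hw, pauli_mul _ _ _ _ _ _⟩
  inv_mem' := by
    rintro _ ⟨s, v, hv, rfl⟩
    exact ⟨_, v, hv, pauli_inv _ _ _⟩

theorem pauli_mem_fullPreimage {C : Submodule (ZMod 2) (PhaseSpace ι)} {s : ZMod 2}
    {v : PhaseSpace ι} : pauli s v.1 v.2 ∈ fullPreimage C ↔ v ∈ C := by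
  constructor
  · rintro ⟨t, w, hw, h⟩
    obtain ⟨-, h1, h2⟩ := pauli_injective h
    rwa [show v = w from Prod.ext h1 h2]
  · exact fun hv => ⟨s, v, hv, rfl⟩

theorem tau_fullPreimage (C : Submodule (ZMod 2) (PhaseSpace ι)) :
    tau (fullPreimage C) = (C : Set (PhaseSpace ι)) := by
  ext v
  exact ⟨fun ⟨_, h⟩ => pauli_mem_fullPreimage.1 h, fun h => ⟨0, pauli_mem_fullPreimage.2 h⟩⟩

theorem pauli_mem_normalizer_iff {S : Subgroup (PauliGroup ι)} {s : ZMod 2} {v : PhaseSpace ι} :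
    pauli s v.1 v.2 ∈ normalizer S ↔ ∀ w ∈ tau S, symp v w = 0 := by
  rw [normalizer, Subgroup.mem_centralizer_iff]
  constructor
  · rintro h w ⟨t, hw⟩
    exact (pauli_commute_iff s t v w).1 (h _ hw).symm
  · intro h g hg
    obtain ⟨t, a, b, rfl⟩ := exists_eq_pauli g
    exact ((pauli_commute_iff s t v (a, b)).2 (h (a, b) ⟨t, hg⟩)).symm

theorem mem_tau_normalizer_iff {S : Subgroup (PauliGroup ι)} {v : PhaseSpace ι} :
    v ∈ tau (normalizer S) ↔ ∀ w ∈ tau S, symp v w = 0 :=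
  ⟨fun ⟨_, h⟩ => pauli_mem_normalizer_iff.1 h, fun h => ⟨0, pauli_mem_normalizer_iff.2 h⟩⟩

/-- Forgetting signs respects this intersection because membership in a normalizer does not depend
on the sign. -/
theorem tau_isotropicPart (S : Subgroup (PauliGroup ι)) :
    tau (isotropicPart S) = tau S ∩ tau (normalizer S) := by
  ext v
  constructor
  · rintro ⟨s, h1, h2⟩
    exact ⟨⟨s, h1⟩, s, h2⟩
  · rintro ⟨⟨s, h1⟩, h2⟩
    exact ⟨s, h1, pauli_mem_normalizer_iff.2 (mem_tau_normalizer_iff.1 h2)⟩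

/-! ### Dimension of a stabilizer code -/

theorem trace_pauliOp_zero_zero :
    (pauliOp 0 (0 : ι → ZMod 2) 0).trace = 2 ^ Fintype.card ι := by
  rw [pauliOp_zero, Matrix.trace_one, Fintype.card_fun, ZMod.card]
  push_cast
  rfl

theorem exists_symp_ne_zero {v : PhaseSpace ι} (hv : v ≠ 0) : ∃ w, symp v w ≠ 0 := by
  by_contra! h
  apply hv
  refine Prod.ext (funext fun i => ?_) (funext fun i => ?_)
  · simpa [symp_apply] using h (0, Pi.single i 1)
  · simpa [symp_apply] using h (Pi.single i 1, 0)

theorem pauli_one_zero_mul (s : ZMod 2) (a b : ι → ZMod 2) :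
    pauliOp (s + 1) a b = -pauliOp s a b := by
  ext i j
  rw [Matrix.neg_apply, pauliOp_apply, pauliOp_apply]
  split_ifs
  · rw [show s + 1 + b ⬝ᵥ j = (s + b ⬝ᵥ j) + 1 by ring, neg_one_pow_val_add]
    simp [ZMod.val_one]
  · simp

/-- By nondegeneracy of the symplectic form some Pauli operator anticommutes with this one;
conjugating by it preserves the trace and also negates it. -/
theorem trace_pauliOp_of_ne_zero (s : ZMod 2) {v : PhaseSpace ι} (hv : v ≠ 0) :
    (pauliOp s v.1 v.2).trace = 0 := by
  obtain ⟨w, hw⟩ := exists_symp_ne_zero hv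
  have h1 : pauliOp 0 w.1 w.2 * pauliOp s v.1 v.2 = -(pauliOp s v.1 v.2 * pauliOp 0 w.1 w.2) := by
    rw [pauliOp_mul, pauliOp_mul, ← pauli_one_zero_mul]
    have h2 : w.2 ⬝ᵥ v.1 = v.2 ⬝ᵥ w.1 + 1 := by
      have h3 : symp v w = 1 := zmod_two_eq_one_of_ne_zero hw
      rw [symp_eq_cocycle, cocycle_apply, cocycle_apply] at h3
      rw [← h3, ← add_assoc, CharTwo.add_self_eq_zero, zero_add]
    rw [h2, add_comm w.1, add_comm w.2]
    congr 1
    ring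
  have h2 : (pauliOp s v.1 v.2).trace = -(pauliOp s v.1 v.2).trace := by
    calc (pauliOp s v.1 v.2).trace
        = (pauliOp (0 + w.2 ⬝ᵥ w.1) w.1 w.2 * (pauliOp 0 w.1 w.2 * pauliOp s v.1 v.2)).trace := by
          rw [← mul_assoc, pauliOp_inv_mul, one_mul]
      _ = -(pauliOp s v.1 v.2 * pauliOp 0 w.1 w.2 * pauliOp (0 + w.2 ⬝ᵥ w.1) w.1 w.2).trace := by
          rw [h1, mul_neg, Matrix.trace_neg, Matrix.trace_mul_comm]
      _ = -(pauliOp s v.1 v.2).trace := by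
          rw [mul_assoc, pauliOp_mul_inv, mul_one]
  exact self_eq_neg.1 h2

theorem IsStabilizer.trace_eq {T : Subgroup (PauliGroup ι)} (hT : IsStabilizer T)
    {g : PauliGroup ι} (hg : g ∈ T) :
    (((g : (Operator ι)ˣ) : Operator ι)).trace = if g = 1 then 2 ^ Fintype.card ι else 0 := by
  split_ifs with h
  · rw [h, ← pauli_zero, coe_pauli, trace_pauliOp_zero_zero]
  · obtain ⟨s, a, b, rfl⟩ := exists_eq_pauli g
    rw [coe_pauli]
    refine trace_pauliOp_of_ne_zero s (v := (a, b)) fun h0 => ?_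
    obtain ⟨rfl, rfl⟩ := Prod.mk.inj h0
    rcases eq_or_ne s 0 with rfl | hs
    · exact h pauli_zero
    · rw [zmod_two_eq_one_of_ne_zero hs] at hg
      exact hT.phase_not_mem hg

/-- The average `P` of the group is a projection onto the fixed space, so its trace is the
dimension; all elements except the identity are traceless. -/
theorem IsStabilizer.card_mul_finrank_codeSpace {T : Subgroup (PauliGroup ι)} [Finite T]
    (hT : IsStabilizer T) :
    Nat.card T * Module.finrank ℂ (codeSpace T) = 2 ^ Fintype.card ι := by
  have := Fintype.ofFinite T
  let M : T → Operator ι := fun g => ((g : PauliGroup ι) : (Operator ι)ˣ)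
  have hM : ∀ g h : T, M (g * h) = M g * M h := fun _ _ => rfl
  have hc : (Fintype.card T : ℂ) ≠ 0 := Nat.cast_ne_zero.2 Fintype.card_ne_zero
  let P : Operator ι := (Fintype.card T : ℂ)⁻¹ • ∑ g : T, M g
  have hP : LinearMap.IsProj (codeSpace T) (Matrix.toLin' P) := by
    constructor
    · intro x g hg
      have h1 : M ⟨g, hg⟩ * P = P := by
        simp only [P, mul_smul_comm, Finset.mul_sum, ← hM]
        congr 1
        exact Fintype.sum_equiv (Equiv.mulLeft (⟨g, hg⟩ : T)) _ _ fun _ => rfl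
      rw [Matrix.toLin'_apply, Matrix.mulVec_mulVec]
      exact congrArg (fun A : Operator ι => A.mulVec x) h1
    · intro x hx
      rw [Matrix.toLin'_apply, Matrix.smul_mulVec, Matrix.sum_mulVec,
        Finset.sum_congr rfl fun g _ => hx g.1 g.2, Finset.sum_const, Finset.card_univ,
        ← Nat.cast_smul_eq_nsmul ℂ, smul_smul, inv_mul_cancel₀ hc, one_smul]
  have h1 := hP.trace
  rw [Matrix.trace_toLin'_eq, Matrix.trace_smul, Matrix.trace_sum] at h1
  have h2 : ∑ g : T, (M g).trace = 2 ^ Fintype.card ι := by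
    rw [Finset.sum_eq_single (1 : T)]
    · exact (hT.trace_eq (one_mem T)).trans (if_pos rfl)
    · intro g _ hg
      exact (hT.trace_eq g.2).trans (if_neg fun h => hg (Subtype.ext h))
    · simp
  rw [h2, smul_eq_mul, inv_mul_eq_iff_eq_mul₀ hc] at h1
  rw [Nat.card_eq_fintype_card]
  exact_mod_cast h1.symm

end PhaseSpace

/-! ### Stabilizer groups from totally singular subspaces -/

/-- An alternating bilinear form over `𝔽₂` is a coboundary. -/
theorem exists_coboundary {W : Type*} [AddCommGroup W] [Module (ZMod 2) W]
    [Module.Finite (ZMod 2) W] (B : LinearMap.BilinForm (ZMod 2) W) (hB : B.IsAlt) :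
    ∃ φ : W → ZMod 2, ∀ v w, φ (v + w) = φ v + φ w + B v w := by
  let b := Module.finBasis (ZMod 2) W
  -- `A` is the strictly upper triangular part of the Gram matrix of `B`. Since `B` is alternating,
  -- `B v w = A v w + A w v`, so `B` is the polarization of the quadratic form `A v v`.
  let A : W → W → ZMod 2 := fun v w =>
    ∑ i, ∑ j, if i < j then b.repr v i * b.repr w j * B (b i) (b j) else 0
  have hsymm : ∀ v w, B v w = B w v := fun v w => by
    rw [← hB.neg_eq v w, CharTwo.neg_eq]
  have hadd : ∀ v w, B v w = A v w + A w v := by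
    intro v w
    have h1 : A w v = ∑ i, ∑ j, if j < i then b.repr v i * b.repr w j * B (b i) (b j) else 0 := by
      simp only [A]
      rw [Finset.sum_comm]
      refine Finset.sum_congr rfl fun i _ => Finset.sum_congr rfl fun j _ => ?_
      rw [hsymm (b j), mul_comm (b.repr w j)]
    rw [h1, ← LinearMap.BilinForm.sum_repr_mul_repr_mul b v w, Finsupp.sum_fintype _ _ (by simp)]
    simp only [A, ← Finset.sum_add_distrib]
    refine Finset.sum_congr rfl fun i _ => ?_
    rw [Finsupp.sum_fintype _ _ (by simp)]
    refine Finset.sum_congr rfl fun j _ => ?_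
    rcases lt_trichotomy i j with h | rfl | h
    · simp [h, h.not_gt, mul_assoc]
    · simp [hB.self_eq_zero]
    · simp [h, h.not_gt, mul_assoc]
  refine ⟨fun v => A v v, fun v w => ?_⟩
  rw [hadd]
  simp only [A, ← Finset.sum_add_distrib]
  refine Finset.sum_congr rfl fun i _ => Finset.sum_congr rfl fun j _ => ?_
  rw [map_add, Finsupp.add_apply, Finsupp.add_apply]
  split_ifs
  · ring
  · simp

section Stabilizer

variable {ι : Type} [Fintype ι]

/-- A subspace is totally singular if its elements have an even number of `Y`s; such a subspace is
isotropic. -/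
def IsTotallySingular (W : Submodule (ZMod 2) (PhaseSpace ι)) : Prop :=
  ∀ v ∈ W, cocycle v v = 0

/-- The diagonal of the cocycle is the quadratic form counting `Y`s mod 2, and its polarization is
the symplectic form. Hence total singularity implies isotropy and can be tested on generators. -/
theorem cocycle_add_self (v w : PhaseSpace ι) :
    cocycle (v + w) (v + w) = cocycle v v + cocycle w w + symp v w := by
  rw [symp_eq_cocycle, map_add, map_add, LinearMap.add_apply, LinearMap.add_apply]
  ring

theorem IsTotallySingular.symp_eq_zero {W : Submodule (ZMod 2) (PhaseSpace ι)}
    (hW : IsTotallySingular W) {v w : PhaseSpace ι} (hv : v ∈ W) (hw : w ∈ W) :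
    symp v w = 0 := by
  have h := cocycle_add_self v w
  rw [hW _ hv, hW _ hw, hW _ (W.add_mem hv hw)] at h
  simpa using h.symm

theorem isTotallySingular_span {s : Set (PhaseSpace ι)} (h1 : ∀ v ∈ s, cocycle v v = 0)
    (h2 : ∀ v ∈ s, ∀ w ∈ s, symp v w = 0) : IsTotallySingular (Submodule.span (ZMod 2) s) := by
  have h3 : ∀ v ∈ s, ∀ w ∈ Submodule.span (ZMod 2) s, symp v w = 0 := fun v hv w hw =>
    Submodule.span_le (p := LinearMap.ker (symp v)).2 (fun w hw => h2 v hv w hw) hw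
  have h4 : ∀ v ∈ Submodule.span (ZMod 2) s, ∀ w ∈ Submodule.span (ZMod 2) s, symp v w = 0 :=
    fun v hv w hw => by
      rw [symp_comm]
      exact Submodule.span_le (p := LinearMap.ker (symp w)).2
        (fun v hv => by
          rw [SetLike.mem_coe, LinearMap.mem_ker, symp_comm]
          exact h3 v hv w hw) hv
  intro v hv
  induction hv using Submodule.span_induction with
  | mem x hx => exact h1 x hx
  | zero => simp
  | add x y hx hy hx' hy' => rw [cocycle_add_self, hx', hy', h4 x hx y hy]; simp
  | smul a x _ hx => simp [hx]

variable [DecidableEq ι]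

/-- A function `φ` whose coboundary is the cocycle on `W` chooses signs that turn the labelling into
a homomorphism from `W`. The chosen operators form a group isomorphic to `W`, and `φ 0 = 0` keeps -I
out. -/
theorem IsTotallySingular.exists_isStabilizer {W : Submodule (ZMod 2) (PhaseSpace ι)}
    (hW : IsTotallySingular W) :
    ∃ T : Subgroup (PauliGroup ι), IsStabilizer T ∧ tau T = (W : Set (PhaseSpace ι)) ∧
      Finite T ∧ Nat.card T = Nat.card W := by
  obtain ⟨φ, hφ⟩ := exists_coboundary (cocycle.domRestrict₁₂ W W) fun v => hW v v.2
  have hφ0 : φ 0 = 0 := by simpa using hφ 0 0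
  let T : Subgroup (PauliGroup ι) :=
    { carrier := {g | ∃ v : W, g = pauli (φ v) v.1.1 v.1.2}
      one_mem' := ⟨0, by rw [hφ0]; exact pauli_zero.symm⟩
      mul_mem' := by
        rintro _ _ ⟨v, rfl⟩ ⟨w, rfl⟩
        refine ⟨v + w, ?_⟩
        rw [hφ, pauli_mul]
        rfl
      inv_mem' := by
        rintro _ ⟨v, rfl⟩
        refine ⟨v, ?_⟩
        rw [pauli_inv, show v.1.2 ⬝ᵥ v.1.1 = 0 from hW v v.2, add_zero] }
  let f : W → T := fun v => ⟨pauli (φ v) v.1.1 v.1.2, v, rfl⟩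
  have hf : Function.Bijective f := by
    constructor
    · intro v w h
      obtain ⟨-, h1, h2⟩ := pauli_injective (congrArg Subtype.val h)
      exact Subtype.ext (Prod.ext h1 h2)
    · rintro ⟨_, v, rfl⟩
      exact ⟨v, rfl⟩
  refine ⟨T, ⟨?_, ?_⟩, ?_, Finite.of_surjective f hf.2, (Nat.card_eq_of_bijective f hf).symm⟩
  · rintro _ ⟨v, rfl⟩ _ ⟨w, rfl⟩
    exact (pauli_commute_iff _ _ v.1 w.1).2 (hW.symp_eq_zero v.2 w.2)
  · rintro ⟨v, h⟩
    obtain ⟨h0, h1, h2⟩ := pauli_injective h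
    rw [show v = 0 from Subtype.ext (Prod.ext h1.symm h2.symm), hφ0] at h0
    exact one_ne_zero h0
  · ext v
    constructor
    · rintro ⟨s, w, h⟩
      obtain ⟨-, h1, h2⟩ := pauli_injective h
      rw [show v = w.1 from Prod.ext h1 h2]
      exact w.2
    · exact fun hv => ⟨φ ⟨v, hv⟩, ⟨v, hv⟩, rfl⟩

end Stabilizer

/-! ### Symplectic frames -/

/-- A symplectic frame: two families `e`, `f` of hyperbolic pairs. -/
structure SymplecticFrame (ι J : Type) [Fintype ι] [DecidableEq J] where
  e : J → PhaseSpace ι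
  f : J → PhaseSpace ι
  symp_e_e : ∀ i j, symp (e i) (e j) = 0
  symp_f_f : ∀ i j, symp (f i) (f j) = 0
  symp_e_f : ∀ i j, symp (e i) (f j) = if i = j then 1 else 0

namespace SymplecticFrame

variable {ι J : Type} [Fintype ι] [DecidableEq J]

theorem symp_f_e (F : SymplecticFrame ι J) (i j : J) :
    symp (F.f i) (F.e j) = if i = j then 1 else 0 := by
  rw [symp_comm, F.symp_e_f]
  exact if_congr eq_comm rfl rfl

/-- The vectors of a frame as one family. -/
def vec (F : SymplecticFrame ι J) : J ⊕ J → PhaseSpace ι := Sum.elim F.e F.f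

/-- Swapping the two summands of the index set passes to the dual basis; linear independence and the
coordinate formula below rest on this. -/
theorem symp_vec_swap (F : SymplecticFrame ι J) (i j : J ⊕ J) :
    symp (F.vec i) (F.vec j.swap) = if i = j then 1 else 0 := by
  rcases i with i | i <;> rcases j with j | j <;>
    simp [vec, F.symp_e_e, F.symp_f_f, F.symp_e_f, F.symp_f_e]

variable [Fintype J]

theorem linearIndependent (F : SymplecticFrame ι J) : LinearIndependent (ZMod 2) F.vec := by
  rw [Fintype.linearIndependent_iff]
  intro c hc i
  have h : symp (∑ j, c j • F.vec j) (F.vec i.swap) = 0 := by rw [hc]; simp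
  simpa [LinearMap.sum_apply, F.symp_vec_swap, -Fintype.sum_sum_type] using h

theorem span_range_eq_top (F : SymplecticFrame ι J) (hJ : Fintype.card J = Fintype.card ι) :
    Submodule.span (ZMod 2) (Set.range F.vec) = ⊤ := by
  apply F.linearIndependent.span_eq_top_of_card_eq_finrank'
  simp [hJ]

theorem sum_symp_smul (F : SymplecticFrame ι J) (hJ : Fintype.card J = Fintype.card ι)
    (v : PhaseSpace ι) : ∑ i, symp v (F.vec i.swap) • F.vec i = v := by
  have hv : v ∈ Submodule.span (ZMod 2) (Set.range F.vec) := by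
    rw [F.span_range_eq_top hJ]; trivial
  obtain ⟨c, rfl⟩ := (Submodule.mem_span_range_iff_exists_fun _).1 hv
  refine Finset.sum_congr rfl fun i _ => ?_
  simp [LinearMap.sum_apply, F.symp_vec_swap, -Fintype.sum_sum_type]

/-- The span of part of a frame is cut out by the pairings with the dual vectors of the rest. -/
theorem mem_span_image_iff (F : SymplecticFrame ι J) (hJ : Fintype.card J = Fintype.card ι)
    (P : Set (J ⊕ J)) (v : PhaseSpace ι) :
    v ∈ Submodule.span (ZMod 2) (F.vec '' P) ↔ ∀ i ∉ P, symp v (F.vec i.swap) = 0 := by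
  constructor
  · intro hv i hi
    have h : Submodule.span (ZMod 2) (F.vec '' P) ≤
        LinearMap.ker (symp (F.vec i.swap)) := by
      rw [Submodule.span_le]
      rintro _ ⟨j, hj, rfl⟩
      rw [SetLike.mem_coe, LinearMap.mem_ker, symp_comm, F.symp_vec_swap,
        if_neg (ne_of_mem_of_not_mem hj hi)]
    rw [symp_comm]
    exact h hv
  · intro h
    rw [← F.sum_symp_smul hJ v]
    refine Submodule.sum_mem _ fun i _ => ?_
    by_cases hi : i ∈ P
    · exact Submodule.smul_mem _ _ (Submodule.subset_span ⟨i, hi, rfl⟩)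
    · rw [h i hi, zero_smul]
      exact Submodule.zero_mem _

theorem natCard_span_image (F : SymplecticFrame ι J) (P : Set (J ⊕ J)) :
    Nat.card (Submodule.span (ZMod 2) (F.vec '' P)) = 2 ^ P.ncard := by
  classical
  have := Fintype.ofFinite P
  have h := finrank_span_eq_card (F.linearIndependent.comp (Subtype.val : P → J ⊕ J)
    Subtype.val_injective)
  rw [Set.range_comp, Subtype.range_coe] at h
  rw [Module.natCard_eq_pow_finrank (K := ZMod 2), h, Nat.card_zmod, ← Nat.card_eq_fintype_card]
  rfl

end SymplecticFrame

theorem tau_normalizer_of_tau_eq_span {ι : Type} [Fintype ι] [DecidableEq ι]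
    {S : Subgroup (PauliGroup ι)} {s : Set (PhaseSpace ι)}
    (hS : tau S = (Submodule.span (ZMod 2) s : Set (PhaseSpace ι))) :
    tau (normalizer S) = {v | ∀ w ∈ s, symp v w = 0} := by
  ext v
  rw [mem_tau_normalizer_iff, hS]
  exact ⟨fun h w hw => h w (Submodule.subset_span hw), fun h w hw =>
    Submodule.span_le (p := LinearMap.ker (symp v)).2 h hw⟩

theorem finrank_codeSpace_eq {ι : Type} [Fintype ι] [DecidableEq ι] {T : Subgroup (PauliGroup ι)}
    [Finite T] (hT : IsStabilizer T) {r k : ℕ} (hr : Nat.card T = 2 ^ r)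
    (hk : Fintype.card ι = r + k) : Module.finrank ℂ (codeSpace T) = 2 ^ k := by
  have h := hT.card_mul_finrank_codeSpace
  rw [hr, hk, pow_add] at h
  exact Nat.eq_of_mul_eq_mul_left (by positivity) h

/-! ### Stabilizer codes described by a frame. -/

namespace SymplecticFrame

variable {ι L C K : Type}

/-- The vectors of a frame that generate the code group: the isotropic ones, labelled by `L`, and
the hyperbolic pairs labelled by `C`. -/
def codeIndex : L ⊕ C ⊕ C → (L ⊕ C ⊕ K) ⊕ (L ⊕ C ⊕ K) :=
  Sum.elim (fun l => .inl (.inl l))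
    (Sum.elim (fun j => .inl (.inr (.inl j))) (fun j => .inr (.inr (.inl j))))

theorem codeIndex_injective : Function.Injective (codeIndex : L ⊕ C ⊕ C → (L ⊕ C ⊕ K) ⊕ _) := by
  rintro (i | i | i) (j | j | j) h <;> simp_all [codeIndex]

variable [Fintype ι] [DecidableEq L] [DecidableEq C] [DecidableEq K]

/-- The span of the code vectors. -/
def codeSpan (F : SymplecticFrame ι (L ⊕ C ⊕ K)) : Submodule (ZMod 2) (PhaseSpace ι) :=
  Submodule.span (ZMod 2) (F.vec '' Set.range codeIndex)

/-- The labels of the nontrivial logical operators. -/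
def logicals (F : SymplecticFrame ι (L ⊕ C ⊕ K)) : Set (PhaseSpace ι) :=
  {v | (∀ l, symp v (F.e (.inl l)) = 0) ∧
    (∀ j, symp v (F.e (.inr (.inl j))) = 0 ∧ symp v (F.f (.inr (.inl j))) = 0) ∧
    ∃ k, symp v (F.e (.inr (.inr k))) ≠ 0 ∨ symp v (F.f (.inr (.inr k))) ≠ 0}

theorem forall_symp_code_eq_zero_iff (F : SymplecticFrame ι (L ⊕ C ⊕ K)) (v : PhaseSpace ι) :
    (∀ w ∈ F.vec '' Set.range codeIndex, symp v w = 0) ↔ (∀ l, symp v (F.e (.inl l)) = 0) ∧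
      ∀ j, symp v (F.e (.inr (.inl j))) = 0 ∧ symp v (F.f (.inr (.inl j))) = 0 := by
  simp only [Set.forall_mem_image, Set.forall_mem_range, Sum.forall, codeIndex, Sum.elim_inl,
    Sum.elim_inr, vec]
  simp only [forall_and]

variable [Fintype L] [Fintype C] [Fintype K]

/-- The frame vectors outside the span are the `f` of `L` and both vectors of each `K` pair; the
conditions are orthogonality to their duals. -/
theorem mem_codeSpan_iff (F : SymplecticFrame ι (L ⊕ C ⊕ K))
    (hJ : Fintype.card (L ⊕ C ⊕ K) = Fintype.card ι) (v : PhaseSpace ι) :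
    v ∈ F.codeSpan ↔ (∀ l, symp v (F.e (.inl l)) = 0) ∧
      ∀ k, symp v (F.e (.inr (.inr k))) = 0 ∧ symp v (F.f (.inr (.inr k))) = 0 := by
  rw [codeSpan, F.mem_span_image_iff hJ]
  simp only [Sum.forall, codeIndex, Set.mem_range, Sum.exists, Sum.elim_inl, Sum.elim_inr, vec,
    Sum.swap_inl, Sum.swap_inr]
  simp [forall_and]
  tauto

theorem natCard_codeSpan (F : SymplecticFrame ι (L ⊕ C ⊕ K)) :
    Nat.card F.codeSpan = 2 ^ (Fintype.card L + 2 * Fintype.card C) := by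
  rw [codeSpan, natCard_span_image, Set.ncard_range_of_injective codeIndex_injective]
  simp [two_mul]

/-- The `C` pairs are nondegenerate, so the radical of the code span is spanned by the `e` vectors
of `L`. -/
theorem natCard_codeSpan_inter (F : SymplecticFrame ι (L ⊕ C ⊕ K))
    (hJ : Fintype.card (L ⊕ C ⊕ K) = Fintype.card ι) :
    ((F.codeSpan : Set (PhaseSpace ι)) ∩
      {v | ∀ w ∈ F.vec '' Set.range codeIndex, symp v w = 0}).ncard = 2 ^ Fintype.card L := by
  have h : ((F.codeSpan : Set (PhaseSpace ι)) ∩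
      {v | ∀ w ∈ F.vec '' Set.range codeIndex, symp v w = 0}) =
      Submodule.span (ZMod 2) (F.vec '' Set.range fun l : L => .inl (.inl l)) := by
    ext v
    rw [Set.mem_inter_iff, SetLike.mem_coe, SetLike.mem_coe, F.mem_codeSpan_iff hJ,
      Set.mem_ofPred_eq, F.forall_symp_code_eq_zero_iff, F.mem_span_image_iff hJ]
    simp only [Sum.forall, Set.mem_range, vec, Sum.swap_inl, Sum.swap_inr, Sum.elim_inl,
      Sum.elim_inr]
    simp [forall_and]
    tauto
  rw [h]
  refine (natCard_span_image F _).trans ?_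
  rw [Set.ncard_range_of_injective (fun a b h => by simpa using h), Nat.card_eq_fintype_card]

theorem codeSpan_diff (F : SymplecticFrame ι (L ⊕ C ⊕ K))
    (hJ : Fintype.card (L ⊕ C ⊕ K) = Fintype.card ι) :
    {v | ∀ w ∈ F.vec '' Set.range codeIndex, symp v w = 0} \ (F.codeSpan : Set (PhaseSpace ι)) =
      F.logicals := by
  ext v
  rw [Set.mem_sdiff, SetLike.mem_coe, F.mem_codeSpan_iff hJ, Set.mem_ofPred_eq,
    F.forall_symp_code_eq_zero_iff, logicals, Set.mem_ofPred_eq, and_assoc]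
  refine and_congr_right fun h1 => and_congr_right fun _ => ?_
  rw [and_iff_right h1]
  push Not
  simp only [imp_iff_not_or, ne_eq]

/-- A symplectic frame with totally singular isotropic part describes a stabilizer code. -/
theorem exists_stabilizes {m : ℕ} (F : SymplecticFrame (Fin m) (L ⊕ Fin 0 ⊕ K))
    (hm : m = Fintype.card K + Fintype.card L) (hQ : ∀ l, cocycle (F.e (.inl l)) (F.e (.inl l)) = 0)
    {d : ℕ} (hd : IsLeast (weight '' F.logicals) d) :
    ∃ S : Subgroup (PauliGroup (Fin m)), Stabilizes S (Fintype.card K) d := by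
  have hJ : Fintype.card (L ⊕ Fin 0 ⊕ K) = Fintype.card (Fin m) := by
    simp [hm, add_comm]
  have hW : IsTotallySingular F.codeSpan := by
    refine isTotallySingular_span ?_ ?_
    · rintro _ ⟨_, ⟨l | j | j, rfl⟩, rfl⟩
      · exact hQ l
      · exact j.elim0
      · exact j.elim0
    · rintro _ ⟨_, ⟨l | j | j, rfl⟩, rfl⟩ _ ⟨_, ⟨l' | j' | j', rfl⟩, rfl⟩
      · exact F.symp_e_e _ _
      · exact j'.elim0
      · exact j'.elim0
      all_goals exact j.elim0
  obtain ⟨S, hS, hSW, hfin, hcard⟩ := hW.exists_isStabilizer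
  rw [F.natCard_codeSpan, Fintype.card_fin, mul_zero, add_zero] at hcard
  refine ⟨S, hS, ⟨_, hcard, hm⟩, finrank_codeSpace_eq hS hcard ?_, ?_⟩
  · rw [Fintype.card_fin, hm, add_comm]
  · rwa [tau_normalizer_of_tau_eq_span hSW, hSW, F.codeSpan_diff hJ]

end SymplecticFrame

/-! ### Abelian extensions and entanglement-assisted codes. -/

section Extension

variable {α β : Type}

/-- The label on a union of two registers with the given labels on the parts. -/
def joinLabel (v : PhaseSpace α) (w : PhaseSpace β) : PhaseSpace (α ⊕ β) :=
  (Sum.elim v.1 w.1, Sum.elim v.2 w.2)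

theorem cocycle_joinLabel [Fintype α] [Fintype β] (v v' : PhaseSpace α) (w w' : PhaseSpace β) :
    cocycle (joinLabel v w) (joinLabel v' w') = cocycle v v' + cocycle w w' := by
  simp [cocycle_apply, joinLabel, sumElim_dotProduct_sumElim]

theorem symp_joinLabel [Fintype α] [Fintype β] (v v' : PhaseSpace α) (w w' : PhaseSpace β) :
    symp (joinLabel v w) (joinLabel v' w') = symp v v' + symp w w' := by
  simp only [symp_eq_cocycle, cocycle_joinLabel]
  ring

/-- The restriction to the first part of a register. -/
def restrictLeft : PhaseSpace (α ⊕ β) →ₗ[ZMod 2] PhaseSpace α where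
  toFun v := (v.1 ∘ Sum.inl, v.2 ∘ Sum.inl)
  map_add' _ _ := rfl
  map_smul' _ _ := rfl

theorem restrictLeft_joinLabel (v : PhaseSpace α) (w : PhaseSpace β) :
    restrictLeft (joinLabel v w) = v := rfl

end Extension

namespace SymplecticFrame

variable {L K : Type} [DecidableEq L] [DecidableEq K] {n c : ℕ}

/-- The label on the receiver's halves of the ebits that goes with a code vector. -/
def ebitLabel : L ⊕ Fin c ⊕ Fin c → PhaseSpace (Fin c) :=
  Sum.elim (fun _ => 0) (Sum.elim (fun j => (Pi.single j 1, 0)) fun j => (0, Pi.single j 1))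

/-- The code vectors extended to the receiver's halves of the ebits. -/
def extendedVec (F : SymplecticFrame (Fin n) (L ⊕ Fin c ⊕ K)) (t : L ⊕ Fin c ⊕ Fin c) :
    PhaseSpace (Fin n ⊕ Fin c) :=
  joinLabel (F.vec (codeIndex t)) (ebitLabel t)

/-- The receiver's `X` and `Z` on the `j`-th ebit repeat the commutation relations of the `j`-th
code pair, so in characteristic 2 the two contributions cancel in the joint form. -/
theorem symp_ebitLabel (F : SymplecticFrame (Fin n) (L ⊕ Fin c ⊕ K)) (t t' : L ⊕ Fin c ⊕ Fin c) :
    symp (F.vec (codeIndex t)) (F.vec (codeIndex t')) =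
      symp (ebitLabel t) (ebitLabel t') := by
  rcases t with l | j | j <;> rcases t' with l' | j' | j' <;>
    simp [vec, codeIndex, ebitLabel, F.symp_e_e, F.symp_f_f, F.symp_e_f, F.symp_f_e, symp_apply,
      Pi.single_apply, eq_comm]

theorem isTotallySingular_extended (F : SymplecticFrame (Fin n) (L ⊕ Fin c ⊕ K))
    (hL : ∀ l, cocycle (F.e (.inl l)) (F.e (.inl l)) = 0)
    (he : ∀ j, cocycle (F.e (.inr (.inl j))) (F.e (.inr (.inl j))) = 0)
    (hf : ∀ j, cocycle (F.f (.inr (.inl j))) (F.f (.inr (.inl j))) = 0) :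
    IsTotallySingular (Submodule.span (ZMod 2) (Set.range F.extendedVec)) := by
  refine isTotallySingular_span ?_ ?_
  · rintro _ ⟨l | j | j, rfl⟩ <;> rw [extendedVec, cocycle_joinLabel]
    · simpa [ebitLabel, vec, codeIndex] using hL l
    · simpa [ebitLabel, cocycle_apply, vec, codeIndex] using he j
    · simpa [ebitLabel, cocycle_apply, vec, codeIndex] using hf j
  · rintro _ ⟨t, rfl⟩ _ ⟨t', rfl⟩
    rw [extendedVec, extendedVec, symp_joinLabel, symp_ebitLabel, CharTwo.add_self_eq_zero]

/-- The receiver's part is a linear function of the sender's part. This gives the injectivity of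
deleting the receiver's qubits. -/
theorem apply_inr_of_mem_span_extended (F : SymplecticFrame (Fin n) (L ⊕ Fin c ⊕ K))
    {v : PhaseSpace (Fin n ⊕ Fin c)}
    (hv : v ∈ Submodule.span (ZMod 2) (Set.range F.extendedVec)) (j : Fin c) :
    v.1 (.inr j) = symp (restrictLeft v) (F.f (.inr (.inl j))) ∧
      v.2 (.inr j) = symp (restrictLeft v) (F.e (.inr (.inl j))) := by
  induction hv using Submodule.span_induction with
  | mem x hx =>
    obtain ⟨l | i | i, rfl⟩ := hx <;> rw [extendedVec, restrictLeft_joinLabel] <;>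
      simp [joinLabel, vec, codeIndex, ebitLabel, F.symp_e_e, F.symp_f_f, F.symp_e_f, F.symp_f_e,
        Pi.single_apply, eq_comm]
  | zero => simp
  | add x y _ _ hx hy => simp [hx, hy]
  | smul a x _ hx => simp [hx]

theorem bijOn_restrictLeft (F : SymplecticFrame (Fin n) (L ⊕ Fin c ⊕ K)) :
    Set.BijOn restrictAlice
      (Submodule.span (ZMod 2) (Set.range F.extendedVec) : Set (PhaseSpace (Fin n ⊕ Fin c)))
      F.codeSpan := by
  have hmap : (Submodule.span (ZMod 2) (Set.range F.extendedVec)).map restrictLeft =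
      F.codeSpan := by
    rw [Submodule.map_span, codeSpan, ← Set.range_comp, ← Set.range_comp]
    rfl
  refine ⟨fun v hv => ?_, fun v hv w hw h => ?_, fun v hv => ?_⟩
  · rw [← hmap]
    exact Submodule.mem_map_of_mem (f := restrictLeft) hv
  · have hr : restrictLeft v = restrictLeft w := h
    refine Prod.ext (funext fun i => ?_) (funext fun i => ?_) <;> rcases i with i | j
    · exact congrFun (congrArg Prod.fst hr) i
    · rw [(F.apply_inr_of_mem_span_extended hv j).1, hr,
        (F.apply_inr_of_mem_span_extended hw j).1]
    · exact congrFun (congrArg Prod.snd hr) i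
    · rw [(F.apply_inr_of_mem_span_extended hv j).2, hr,
        (F.apply_inr_of_mem_span_extended hw j).2]
  · rw [← hmap] at hv
    obtain ⟨w, hw, rfl⟩ := hv
    exact ⟨w, hw, rfl⟩

variable [Fintype L] [Fintype K]

/-- A symplectic frame whose code vectors have an even number of `Y`s describes an
entanglement-assisted code. -/
theorem exists_eaStabilizes (F : SymplecticFrame (Fin n) (L ⊕ Fin c ⊕ K))
    (hn : n = Fintype.card K + c + Fintype.card L)
    (hL : ∀ l, cocycle (F.e (.inl l)) (F.e (.inl l)) = 0)
    (he : ∀ j, cocycle (F.e (.inr (.inl j))) (F.e (.inr (.inl j))) = 0)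
    (hf : ∀ j, cocycle (F.f (.inr (.inl j))) (F.f (.inr (.inl j))) = 0)
    {d : ℕ} (hd : IsLeast (weight '' F.logicals) d) :
    ∃ S : Subgroup (PauliGroup (Fin n)), EAStabilizes S (Fintype.card K) d c := by
  have hJ : Fintype.card (L ⊕ Fin c ⊕ K) = Fintype.card (Fin n) := by
    simp only [Fintype.card_sum, Fintype.card_fin]
    omega
  have hS := tau_fullPreimage F.codeSpan
  have hN := tau_normalizer_of_tau_eq_span hS
  -- The group may be non-Abelian, and all conditions on it are up to phases, so both signs of every
  -- label are admitted.
  refine ⟨fullPreimage F.codeSpan, ⟨Fintype.card L, ?_, ?_, hn⟩, ?_, ?_⟩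
  · rw [tau_isotropicPart, hN, hS]
    exact F.natCard_codeSpan_inter hJ
  · rw [hS]
    have h := F.natCard_codeSpan
    rw [Fintype.card_fin] at h
    exact h
  · obtain ⟨T, hT, hTW, hfin, hcard⟩ := (F.isTotallySingular_extended hL he hf).exists_isStabilizer
    have hbij := F.bijOn_restrictLeft
    rw [← hTW, ← hS] at hbij
    refine ⟨T, ⟨hT, hbij⟩, ?_⟩
    have hcard' := Nat.card_congr F.bijOn_restrictLeft.equiv
    refine finrank_codeSpace_eq hT (hcard.trans (hcard'.trans F.natCard_codeSpan)) ?_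
    simp only [Fintype.card_sum, Fintype.card_fin]
    omega
  · rwa [tau_isotropicPart, hN, hS, Set.sdiff_inter_self_eq_sdiff, F.codeSpan_diff hJ]

end SymplecticFrame

/-- Restriction of a frame to a subfamily. -/
def SymplecticFrame.comp {ι J J' : Type} [Fintype ι] [DecidableEq J] [DecidableEq J']
    (F : SymplecticFrame ι J) (g : J' → J) (hg : Function.Injective g) :
    SymplecticFrame ι J' where
  e := F.e ∘ g
  f := F.f ∘ g
  symp_e_e _ _ := F.symp_e_e _ _
  symp_f_f _ _ := F.symp_f_f _ _
  symp_e_f i j := by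
    rw [Function.comp_apply, Function.comp_apply, F.symp_e_f]
    exact if_congr hg.eq_iff rfl rfl

/-! ### Replacing qubits by repetition codes -/

section Inflation

set_option linter.unusedSectionVars false

variable {α β : Type} [Fintype α] [DecidableEq α] [Fintype β] [DecidableEq β]
  (π : α → β) (σ : β → α)

/-- The logical operators of the concatenation with repetition codes: `X` acts on a whole fibre of
`π` and `Z` on its base point. -/
def inflate (v : PhaseSpace β) : PhaseSpace α :=
  (v.1 ∘ π, fun j => if σ (π j) = j then v.2 (π j) else 0)

/-- The adjoint of `inflate` with respect to the symplectic forms. -/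
def deflate (w : PhaseSpace α) : PhaseSpace β :=
  (w.1 ∘ σ, fun i => ∑ j with π j = i, w.2 j)

variable {π σ} (hσ : Function.LeftInverse π σ)

include hσ in
theorem sum_fiber_eq (g : α → ZMod 2) (i : β) :
    (∑ j with π j = i, if σ (π j) = j then g j else 0) = g (σ i) := by
  rw [Finset.sum_eq_single_of_mem (σ i) (by simp [hσ i])]
  · rw [hσ i, if_pos rfl]
  · intro j hj hne
    rw [(Finset.mem_filter.1 hj).2, if_neg (Ne.symm hne)]

include hσ in
theorem inflate_snd_dotProduct (v : PhaseSpace β) (x : α → ZMod 2) :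
    (inflate π σ v).2 ⬝ᵥ x = v.2 ⬝ᵥ (x ∘ σ) := by
  simp only [dotProduct, inflate, ite_mul, zero_mul, Function.comp_apply]
  rw [← Finset.sum_fiberwise (g := π)]
  refine Finset.sum_congr rfl fun i _ => ?_
  rw [sum_fiber_eq hσ fun j => v.2 (π j) * x j, hσ i]

theorem inflate_fst_dotProduct (v : PhaseSpace β) (w : PhaseSpace α) :
    (inflate π σ v).1 ⬝ᵥ w.2 = v.1 ⬝ᵥ (deflate π σ w).2 := by
  simp only [dotProduct, inflate, deflate, Function.comp_apply]
  rw [← Finset.sum_fiberwise (g := π)]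
  refine Finset.sum_congr rfl fun i _ => ?_
  rw [Finset.mul_sum]
  exact Finset.sum_congr rfl fun j hj => by rw [(Finset.mem_filter.1 hj).2]

include hσ in
-- This adjointness reduces every pairing with an inflated label to a pairing in the small register.
theorem symp_inflate (v : PhaseSpace β) (w : PhaseSpace α) :
    symp (inflate π σ v) w = symp v (deflate π σ w) := by
  rw [symp_apply, symp_apply, inflate_snd_dotProduct hσ, inflate_fst_dotProduct]
  rfl

include hσ in
theorem deflate_inflate (v : PhaseSpace β) : deflate π σ (inflate π σ v) = v := by
  refine Prod.ext (funext fun i => ?_) (funext fun i => ?_)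
  · simp [deflate, inflate, hσ i]
  · exact (sum_fiber_eq hσ (fun j => v.2 (π j)) i).trans (by rw [hσ i])

include hσ in
theorem cocycle_inflate_self (v : PhaseSpace β) :
    cocycle (inflate π σ v) (inflate π σ v) = cocycle v v := by
  rw [cocycle_apply, inflate_snd_dotProduct hσ, cocycle_apply]
  congr 1
  exact funext fun i => congrArg v.1 (hσ i)

variable (π σ) in
/-- The stabilizer `ZZ` on a qubit of a repetition code and its base point. -/
def repCheck (r : {j : α // σ (π j) ≠ j}) : PhaseSpace α :=
  (0, Pi.single r.1 1 + Pi.single (σ (π r.1)) 1)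

variable (π σ) in
/-- The operator `X` on a qubit of a repetition code that is not its base point. -/
def repFlip (r : {j : α // σ (π j) ≠ j}) : PhaseSpace α :=
  (Pi.single r.1 1, 0)

theorem symp_repCheck (v : PhaseSpace α) (r : {j : α // σ (π j) ≠ j}) :
    symp v (repCheck π σ r) = v.1 r.1 + v.1 (σ (π r.1)) := by
  simp [symp_apply, repCheck, dotProduct_add]

theorem symp_repFlip (v : PhaseSpace α) (r : {j : α // σ (π j) ≠ j}) :
    symp v (repFlip π σ r) = v.2 r.1 := by
  simp [symp_apply, repFlip]

include hσ in
theorem symp_inflate_repCheck (v : PhaseSpace β) (r : {j : α // σ (π j) ≠ j}) :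
    symp (inflate π σ v) (repCheck π σ r) = 0 := by
  rw [symp_repCheck]
  simp [inflate, hσ (π r.1), CharTwo.add_self_eq_zero]

theorem symp_inflate_repFlip (v : PhaseSpace β) (r : {j : α // σ (π j) ≠ j}) :
    symp (inflate π σ v) (repFlip π σ r) = 0 := by
  rw [symp_repFlip]
  exact if_neg r.2

/-- The frame of the concatenation with repetition codes. -/
def SymplecticFrame.inflate {J : Type} [DecidableEq J] (F : SymplecticFrame β J) :
    SymplecticFrame α (J ⊕ {j : α // σ (π j) ≠ j}) where
  e := Sum.elim (fun i => QubitCode.inflate π σ (F.e i)) (repCheck π σ)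
  f := Sum.elim (fun i => QubitCode.inflate π σ (F.f i)) (repFlip π σ)
  symp_e_e := by
    rintro (i | r) (j | s)
    · simpa [symp_inflate hσ, deflate_inflate hσ] using F.symp_e_e i j
    · exact symp_inflate_repCheck hσ _ _
    · exact (symp_comm _ _).trans (symp_inflate_repCheck hσ _ _)
    · rw [Sum.elim_inr, Sum.elim_inr, symp_repCheck]
      simp [repCheck]
  symp_f_f := by
    rintro (i | r) (j | s)
    · simpa [symp_inflate hσ, deflate_inflate hσ] using F.symp_f_f i j
    · exact symp_inflate_repFlip _ _
    · exact (symp_comm _ _).trans (symp_inflate_repFlip _ _)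
    · rw [Sum.elim_inr, Sum.elim_inr, symp_repFlip]
      simp [repFlip]
  symp_e_f := by
    rintro (i | r) (j | s)
    · simpa [symp_inflate hσ, deflate_inflate hσ] using F.symp_e_f i j
    · simpa using symp_inflate_repFlip _ _
    · simpa using (symp_comm _ _).trans (symp_inflate_repCheck hσ _ _)
    · rw [Sum.elim_inr, Sum.elim_inr, symp_repFlip]
      have h : s.1 ≠ σ (π r.1) := fun h => s.2 (by rw [h, hσ])
      simp [repCheck, Pi.single_apply, h, Subtype.ext_iff, eq_comm]

/-- The weight after replacing the qubit `i` by a repetition code of length `len i`: bit flips act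
on all of its qubits, phase flips on a single one. -/
def inflatedWeight (len : β → ℕ) (v : PhaseSpace β) : ℕ :=
  ∑ i, if v.1 i ≠ 0 then len i else if v.2 i ≠ 0 then 1 else 0

theorem weight_eq_sum_fiber (π : α → β) (v : PhaseSpace α) :
    weight v = ∑ i, (Finset.univ.filter fun j => π j = i ∧ (v.1 j ≠ 0 ∨ v.2 j ≠ 0)).card := by
  rw [weight, Finset.card_eq_sum_card_fiberwise (f := π) (t := Finset.univ) (by simp)]
  refine Finset.sum_congr rfl fun i _ => ?_
  rw [Finset.filter_filter]
  simp only [and_comm]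

variable {len : β → ℕ} (hlen : ∀ i, (Finset.univ.filter fun j => π j = i).card = len i)

include hlen in
-- Commuting with the checks makes the bit flips constant on each fibre, so a flip at the base point
-- fills the fibre. Without one, an odd number of phase flips still needs at least one qubit.
theorem inflatedWeight_deflate_le {v : PhaseSpace α} (hv : ∀ r, symp v (repCheck π σ r) = 0) :
    inflatedWeight len (deflate π σ v) ≤ weight v := by
  rw [weight_eq_sum_fiber π]
  refine Finset.sum_le_sum fun i _ => ?_
  split_ifs with h1 h2
  · rw [← hlen i]
    refine Finset.card_le_card fun j hj => ?_
    have hj : π j = i := (Finset.mem_filter.1 hj).2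
    refine Finset.mem_filter.2 ⟨Finset.mem_univ _, hj, Or.inl ?_⟩
    by_cases hs : σ (π j) = j
    · rw [← hs, hj]
      exact h1
    · have h := hv ⟨j, hs⟩
      rw [symp_repCheck, CharTwo.add_eq_zero] at h
      rw [h, hj]
      exact h1
  · obtain ⟨j, hj, hj'⟩ := Finset.exists_ne_zero_of_sum_ne_zero h2
    exact Finset.card_pos.2
      ⟨j, Finset.mem_filter.2 ⟨Finset.mem_univ _, (Finset.mem_filter.1 hj).2, Or.inr hj'⟩⟩
  · exact Nat.zero_le _

include hσ hlen in
-- Inflated labels attain the preceding bound, so the minimum weight is computed exactly.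
theorem weight_inflate (v : PhaseSpace β) :
    weight (inflate π σ v) = inflatedWeight len v := by
  rw [weight_eq_sum_fiber π]
  refine Finset.sum_congr rfl fun i _ => ?_
  split_ifs with h1 h2
  · rw [← hlen i]
    congr 1
    refine Finset.filter_congr fun j _ => and_iff_left_of_imp fun hj => Or.inl ?_
    simpa [inflate, hj] using h1
  · rw [Finset.card_eq_one]
    refine ⟨σ i, Finset.ext fun j => ?_⟩
    rw [Finset.mem_filter, Finset.mem_singleton]
    constructor
    · rintro ⟨-, rfl, h | h⟩
      · exact absurd h h1
      · by_contra hne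
        exact h (if_neg (Ne.symm hne))
    · rintro rfl
      refine ⟨Finset.mem_univ _, hσ i, Or.inr ?_⟩
      simpa [inflate, hσ i] using h2
  · rw [Finset.card_eq_zero, Finset.filter_eq_empty_iff]
    rintro j - ⟨rfl, h | h⟩
    · exact h1 h
    · refine h2 fun h0 => h ?_
      simp [inflate, h0]

/-- A register splits into blocks of any prescribed positive lengths. -/
theorem exists_blocks {n n₀ : ℕ} {len : Fin n₀ → ℕ} (hlen : ∀ i, 0 < len i)
    (hn : n = ∑ i, len i) : ∃ (π : Fin n → Fin n₀) (σ : Fin n₀ → Fin n),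
      Function.LeftInverse π σ ∧ ∀ i, (Finset.univ.filter fun j => π j = i).card = len i := by
  obtain ⟨ε⟩ : Nonempty (Fin n ≃ Σ i, Fin (len i)) :=
    ⟨Fintype.equivOfCardEq (by simp [hn])⟩
  refine ⟨fun j => (ε j).1, fun i => ε.symm ⟨i, ⟨0, hlen i⟩⟩, fun i => by simp, fun i => ?_⟩
  rw [← Fintype.card_subtype]
  let ε' : {j : Fin n // (ε j).1 = i} ≃ {x : Σ i, Fin (len i) // x.1 = i} :=
    ε.subtypeEquiv fun _ => Iff.rfl
  rw [Fintype.card_congr (ε'.trans (Equiv.sigmaSubtype i)), Fintype.card_fin]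

end Inflation

namespace SymplecticFrame

variable {L K : Type} [Fintype L] [Fintype K] [DecidableEq L] [DecidableEq K] {n n₀ c : ℕ}

/-- Replacing the qubits of an entanglement-assisted code by repetition codes. -/
theorem exists_eaStabilizes_inflate (F : SymplecticFrame (Fin n₀) (L ⊕ Fin c ⊕ K))
    (hn₀ : n₀ = Fintype.card K + c + Fintype.card L)
    (hL : ∀ l, cocycle (F.e (.inl l)) (F.e (.inl l)) = 0)
    (he : ∀ j, cocycle (F.e (.inr (.inl j))) (F.e (.inr (.inl j))) = 0)
    (hf : ∀ j, cocycle (F.f (.inr (.inl j))) (F.f (.inr (.inl j))) = 0)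
    {len : Fin n₀ → ℕ} (hlen : ∀ i, 0 < len i) (hn : n = ∑ i, len i)
    {d : ℕ} (hd : IsLeast (inflatedWeight len '' F.logicals) d) :
    ∃ S : Subgroup (PauliGroup (Fin n)), EAStabilizes S (Fintype.card K) d c := by
  obtain ⟨π, σ, hσ, hcard⟩ := exists_blocks hlen hn
  -- The base points are the fixed points of `σ ∘ π`, one for each original qubit; every other qubit
  -- contributes one check.
  have hR : n = n₀ + Fintype.card {j : Fin n // σ (π j) ≠ j} := by
    rw [Fintype.card_subtype_compl, Fintype.card_fin]
    have h1 : Fintype.card {j : Fin n // σ (π j) = j} = n₀ := by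
      rw [← Fintype.card_fin n₀]
      refine Fintype.card_congr ⟨fun j => π j, fun i => ⟨σ i, by rw [hσ i]⟩, fun j => ?_, hσ⟩
      exact Subtype.ext j.2
    have h2 := Fintype.card_subtype_le fun j : Fin n => σ (π j) = j
    rw [h1, Fintype.card_fin] at h2
    rw [h1]
    omega
  -- The `ZZ` checks join the isotropic part; the ebit pairs and the logical pairs are as many as
  -- before.
  let g : (L ⊕ {j : Fin n // σ (π j) ≠ j}) ⊕ Fin c ⊕ K →
      (L ⊕ Fin c ⊕ K) ⊕ {j : Fin n // σ (π j) ≠ j} :=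
    Sum.elim (Sum.elim (fun l => .inl (.inl l)) .inr) (fun t => .inl (.inr t))
  have hg : Function.Injective g := by
    rintro ((i | i) | i) ((j | j) | j) h <;> simp only [g, Sum.elim_inl, Sum.elim_inr] at h <;>
      simp_all only [Sum.inl.injEq, Sum.inr.injEq, reduceCtorEq]
  let G := (F.inflate hσ).comp g hg
  have hG : ∀ v, v ∈ G.logicals ↔
      (∀ r, symp v (repCheck π σ r) = 0) ∧ deflate π σ v ∈ F.logicals := by
    intro v
    have h : ∀ w, symp v (QubitCode.inflate π σ w) = symp (deflate π σ v) w := fun w => by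
      rw [symp_comm, symp_inflate hσ, symp_comm]
    simp only [logicals, G, comp, inflate, Function.comp_apply, g, Sum.elim_inl, Sum.elim_inr,
      Set.mem_ofPred_eq, Sum.forall, h]
    exact ⟨fun ⟨⟨h1, h2⟩, h3⟩ => ⟨h2, h1, h3⟩, fun ⟨h2, h1, h3⟩ => ⟨⟨h1, h2⟩, h3⟩⟩
  refine G.exists_eaStabilizes ?_ ?_ (fun j => ?_) (fun j => ?_) ?_
  · rw [Fintype.card_sum]
    omega
  · rintro (l | r)
    · rw [show G.e (.inl (.inl l)) = QubitCode.inflate π σ (F.e (.inl l)) from rfl,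
        cocycle_inflate_self hσ, hL]
    · simp [G, comp, inflate, g, cocycle_apply, repCheck]
  · rw [show G.e (.inr (.inl j)) = QubitCode.inflate π σ (F.e (.inr (.inl j))) from rfl,
      cocycle_inflate_self hσ, he]
  · rw [show G.f (.inr (.inl j)) = QubitCode.inflate π σ (F.f (.inr (.inl j))) from rfl,
      cocycle_inflate_self hσ, hf]
  · constructor
    · obtain ⟨v, hv, rfl⟩ := hd.1
      refine ⟨QubitCode.inflate π σ v, (hG _).2 ⟨symp_inflate_repCheck hσ v, ?_⟩,
        weight_inflate hσ hcard v⟩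
      rwa [deflate_inflate hσ]
    · rintro _ ⟨v, hv, rfl⟩
      obtain ⟨h1, h2⟩ := (hG v).1 hv
      exact (hd.2 ⟨_, h2, rfl⟩).trans (inflatedWeight_deflate_le hcard h1)

end SymplecticFrame

/-! ### Codes given by bit masks -/

section Bits

/-- The parity of the number of ones among the lowest `n` bits. -/
def bitParity (x : ℕ) : ℕ → Bool
  | 0 => false
  | n + 1 => bitParity x n ^^ x.testBit n

/-- The number of ones among the lowest `n` bits. -/
def bitCount (x : ℕ) : ℕ → ℕ
  | 0 => 0
  | n + 1 => bitCount x n + (x.testBit n).toNat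

/-- A bit as an element of `𝔽₂`. -/
def bitZMod (b : Bool) : ZMod 2 := if b then 1 else 0

theorem bitZMod_eq_zero {b : Bool} : bitZMod b = 0 ↔ b = false := by
  revert b; decide

theorem bitZMod_xor (a b : Bool) : bitZMod (a ^^ b) = bitZMod a + bitZMod b := by
  revert a b; decide

theorem bitZMod_and (a b : Bool) : bitZMod (a && b) = bitZMod a * bitZMod b := by
  revert a b; decide

theorem bitZMod_decide (x : ZMod 2) : bitZMod (decide (x = 1)) = x := by
  revert x; decide

theorem sum_bitZMod_testBit (x n : ℕ) :
    ∑ i : Fin n, bitZMod (x.testBit i) = bitZMod (bitParity x n) := by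
  induction n with
  | zero => rfl
  | succ n ih =>
    rw [Fin.sum_univ_castSucc, bitParity, bitZMod_xor, ← ih]
    rfl

theorem sum_toNat_testBit (x n : ℕ) :
    ∑ i : Fin n, (x.testBit i).toNat = bitCount x n := by
  induction n with
  | zero => rfl
  | succ n ih =>
    rw [Fin.sum_univ_castSucc, bitCount, ← ih]
    rfl

/-- The phase space vector whose two components are given by bit masks. -/
def ofBits (n : ℕ) (b : ℕ × ℕ) : PhaseSpace (Fin n) :=
  (fun i => bitZMod (b.1.testBit i), fun i => bitZMod (b.2.testBit i))

/-- Addition of phase space vectors in terms of bit masks. -/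
def bitAdd (b b' : ℕ × ℕ) : ℕ × ℕ := (b.1 ^^^ b'.1, b.2 ^^^ b'.2)

/-- The symplectic form in terms of bit masks. -/
def bitSymp (n : ℕ) (b b' : ℕ × ℕ) : Bool :=
  bitParity (b.1 &&& b'.2) n ^^ bitParity (b.2 &&& b'.1) n

theorem ofBits_bitAdd (n : ℕ) (b b' : ℕ × ℕ) :
    ofBits n (bitAdd b b') = ofBits n b + ofBits n b' := by
  refine Prod.ext (funext fun i => ?_) (funext fun i => ?_) <;>
    simp [ofBits, bitAdd, Nat.testBit_xor, bitZMod_xor]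

theorem dotProduct_bits (n x y : ℕ) :
    (fun i : Fin n => bitZMod (x.testBit i)) ⬝ᵥ (fun i : Fin n => bitZMod (y.testBit i)) =
      bitZMod (bitParity (x &&& y) n) := by
  simp [dotProduct, ← sum_bitZMod_testBit, Nat.testBit_and, bitZMod_and]

theorem symp_ofBits (n : ℕ) (b b' : ℕ × ℕ) :
    symp (ofBits n b) (ofBits n b') = bitZMod (bitSymp n b b') := by
  rw [bitSymp, bitZMod_xor, ← dotProduct_bits, ← dotProduct_bits]
  rfl

theorem symp_ofBits_eq_zero {n : ℕ} {b b' : ℕ × ℕ} :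
    symp (ofBits n b) (ofBits n b') = 0 ↔ bitSymp n b b' = false := by
  rw [symp_ofBits, bitZMod_eq_zero]

theorem cocycle_ofBits_self {n : ℕ} {b : ℕ × ℕ} (h : bitParity (b.1 &&& b.2) n = false) :
    cocycle (ofBits n b) (ofBits n b) = 0 := by
  rw [cocycle_apply, dotProduct_comm]
  exact (dotProduct_bits n b.1 b.2).trans (bitZMod_eq_zero.2 h)

theorem weight_ofBits (n : ℕ) (b : ℕ × ℕ) : weight (ofBits n b) = bitCount (b.1 ||| b.2) n := by
  rw [weight, Finset.card_filter, ← sum_toNat_testBit]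
  refine Finset.sum_congr rfl fun i _ => ?_
  simp only [ofBits, ne_eq, bitZMod_eq_zero, Nat.testBit_or]
  cases b.1.testBit i <;> cases b.2.testBit i <;> rfl

/-- The lengths of repetition codes: `m` for the qubits in the bit mask `long`, one for the
others. -/
def blockLength (n long m : ℕ) (i : Fin n) : ℕ := if long.testBit i then m else 1

theorem sum_blockLength (n long : ℕ) {m : ℕ} (hm : 0 < m) :
    ∑ i, blockLength n long m i = n + (m - 1) * bitCount long n := by
  rw [← sum_toNat_testBit, Finset.mul_sum]
  calc ∑ i, blockLength n long m i
      = ∑ i : Fin n, (1 + (m - 1) * (long.testBit i).toNat) := by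
        refine Finset.sum_congr rfl fun i _ => ?_
        rw [blockLength]
        cases long.testBit i <;> simp
        omega
    _ = _ := by rw [Finset.sum_add_distrib]; simp

theorem inflatedWeight_ofBits (n long : ℕ) {m : ℕ} (hm : 0 < m) (b : ℕ × ℕ) :
    inflatedWeight (blockLength n long m) (ofBits n b) =
      bitCount (b.1 ||| b.2) n + (m - 1) * bitCount (b.1 &&& long) n := by
  rw [inflatedWeight, ← sum_toNat_testBit, ← sum_toNat_testBit, Finset.mul_sum,
    ← Finset.sum_add_distrib]
  refine Finset.sum_congr rfl fun i _ => ?_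
  simp only [ofBits, blockLength, ne_eq, bitZMod_eq_zero, Nat.testBit_or, Nat.testBit_and]
  cases b.1.testBit i <;> cases b.2.testBit i <;> cases long.testBit i <;> simp <;> omega

/-! #### Frames -/

/-- The `i`-th vector of a list of bit masks. -/
def bitVec (V : List (ℕ × ℕ)) (i : ℕ) : ℕ × ℕ := V.getD i (0, 0)

/-- The test whether two lists of bit masks form a symplectic frame. -/
def isBitFrame (n : ℕ) (E F : List (ℕ × ℕ)) : Bool :=
  (List.range n).all fun i => (List.range n).all fun j =>
    !bitSymp n (bitVec E i) (bitVec E j) && !bitSymp n (bitVec F i) (bitVec F j) &&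
      (bitSymp n (bitVec E i) (bitVec F j) == decide (i = j))

theorem forall_lt_of_all_range {n : ℕ} {p : ℕ → Bool} (h : (List.range n).all p = true) {i : ℕ}
    (hi : i < n) : p i = true :=
  List.all_eq_true.1 h i (List.mem_range.2 hi)

/-- The symplectic frame given by lists of bit masks. -/
def bitFrame {n : ℕ} {E F : List (ℕ × ℕ)} (h : isBitFrame n E F = true) :
    SymplecticFrame (Fin n) (Fin n) where
  e i := ofBits n (bitVec E i)
  f i := ofBits n (bitVec F i)
  symp_e_e i j := by
    have h1 := forall_lt_of_all_range (forall_lt_of_all_range h i.2) j.2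
    simp only [Bool.and_eq_true, Bool.not_eq_true'] at h1
    exact symp_ofBits_eq_zero.2 h1.1.1
  symp_f_f i j := by
    have h1 := forall_lt_of_all_range (forall_lt_of_all_range h i.2) j.2
    simp only [Bool.and_eq_true, Bool.not_eq_true'] at h1
    exact symp_ofBits_eq_zero.2 h1.1.2
  symp_e_f i j := by
    have h1 := forall_lt_of_all_range (forall_lt_of_all_range h i.2) j.2
    simp only [Bool.and_eq_true, beq_iff_eq] at h1
    rw [symp_ofBits, h1.2]
    simp [bitZMod, Fin.ext_iff]

/-- The order of the vectors in a list: first the isotropic ones, then the code pairs, then the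
logical pairs. -/
def blockIndex {n l c k : ℕ} (hn : n = l + (c + k)) : Fin l ⊕ Fin c ⊕ Fin k → Fin n :=
  Sum.elim (fun i => ⟨i, by omega⟩)
    (Sum.elim (fun i => ⟨l + i, by omega⟩) (fun i => ⟨l + c + i, by omega⟩))

theorem blockIndex_injective {n l c k : ℕ} (hn : n = l + (c + k)) :
    Function.Injective (blockIndex (l := l) (c := c) hn) := by
  rintro (i | i | i) (j | j | j) h <;> simp [blockIndex, Fin.ext_iff] at h ⊢ <;> omega

/-- The labels of nontrivial logical operators in terms of bit masks. -/
def isBitLogical (n l c k : ℕ) (E F : List (ℕ × ℕ)) (b : ℕ × ℕ) : Bool :=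
  ((List.range l).all fun i => !bitSymp n b (bitVec E i)) &&
  ((List.range c).all fun i =>
    !bitSymp n b (bitVec E (l + i)) && !bitSymp n b (bitVec F (l + i))) &&
  ((List.range k).any fun i =>
    bitSymp n b (bitVec E (l + c + i)) || bitSymp n b (bitVec F (l + c + i)))

theorem ofBits_mem_logicals_iff {n l c k : ℕ} (hn : n = l + (c + k)) {E F : List (ℕ × ℕ)}
    (h : isBitFrame n E F = true) {b : ℕ × ℕ} :
    ofBits n b ∈ ((bitFrame h).comp (blockIndex hn) (blockIndex_injective hn)).logicals ↔
      isBitLogical n l c k E F b = true := by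
  simp [SymplecticFrame.logicals, SymplecticFrame.comp, bitFrame, blockIndex, isBitLogical,
    symp_ofBits_eq_zero, Fin.forall_iff, Fin.exists_iff, and_assoc]

/-! #### Enumeration of a span -/

/-- The test whether `p` holds for `b` plus any sum of vectors from a list. -/
def forallSpan (p : ℕ × ℕ → Bool) : List (ℕ × ℕ) → ℕ × ℕ → Bool
  | [], b => p b
  | g :: gs, b => forallSpan p gs b && forallSpan p gs (bitAdd g b)

/-- The offset `b` is arbitrary because it accumulates the generators already chosen during the
recursion. -/
theorem exists_of_forallSpan {n : ℕ} {p : ℕ × ℕ → Bool} {gs : List (ℕ × ℕ)} {b : ℕ × ℕ}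
    (h : forallSpan p gs b = true) {v : PhaseSpace (Fin n)}
    (hv : v ∈ Submodule.span (ZMod 2) (ofBits n '' {g | g ∈ gs})) :
    ∃ b', ofBits n b' = v + ofBits n b ∧ p b' = true := by
  induction gs generalizing b v with
  | nil =>
    refine ⟨b, ?_, h⟩
    have hv0 : v = 0 := by simpa using hv
    rw [hv0, zero_add]
  | cons g gs ih =>
    rw [forallSpan, Bool.and_eq_true] at h
    have hset : ofBits n '' {x | x ∈ g :: gs} = insert (ofBits n g) (ofBits n '' {x | x ∈ gs}) := by
      rw [← Set.image_insert_eq]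
      congr 1
      ext x
      simp
    rw [hset, Submodule.mem_span_insert] at hv
    obtain ⟨a, w, hw, rfl⟩ := hv
    rcases eq_or_ne a 0 with rfl | ha
    · rw [zero_smul, zero_add]
      exact ih h.1 hw
    · obtain ⟨b', hb', hp⟩ := ih h.2 hw
      refine ⟨b', ?_, hp⟩
      rw [hb', ofBits_bitAdd, zmod_two_eq_one_of_ne_zero ha, one_smul]
      abel

/-! #### Entanglement-assisted codes -/

/-- The numerical conditions for an entanglement-assisted code: the frame property, an even number
of `Y`s in the code vectors, and, for all logical labels, bounds on the number `h` of bit flips on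
`long` qubits and on the sum of `h` with the weight, which are attained by `wit`. -/
def isBitEACode (n l c k long T hmin : ℕ) (E F : List (ℕ × ℕ)) (wit : ℕ × ℕ) : Bool :=
  decide (n = l + (c + k)) && isBitFrame n E F &&
  ((List.range (l + c)).all fun i => !bitParity ((bitVec E i).1 &&& (bitVec E i).2) n) &&
  ((List.range c).all fun i => !bitParity ((bitVec F (l + i)).1 &&& (bitVec F (l + i)).2) n) &&
  forallSpan (fun b => (decide (hmin ≤ bitCount (b.1 &&& long) n) &&
      decide (T ≤ bitCount (b.1 ||| b.2) n + bitCount (b.1 &&& long) n)) ||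
      (List.range k).all fun i =>
        !bitSymp n b (bitVec E (l + c + i)) && !bitSymp n b (bitVec F (l + c + i)))
    ((List.range l).map (bitVec E) ++ ((List.range k).map fun i => bitVec E (l + c + i)) ++
      (List.range k).map fun i => bitVec F (l + c + i)) (0, 0) &&
  isBitLogical n l c k E F wit && decide (bitCount (wit.1 &&& long) n = hmin) &&
  decide (bitCount (wit.1 ||| wit.2) n + bitCount (wit.1 &&& long) n = T)

/-- The inflated weight is (w+h) + (m-2)h, with w the weight and h the number of bit flips on long
qubits. As m ≥ 2, separate lower bounds for w+h and h that a single witness attains determine the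
minimum for every m. -/
theorem exists_eaStabilizes_of_check (n l c k long T hmin : ℕ) (E F : List (ℕ × ℕ))
    (wit : ℕ × ℕ) (h : isBitEACode n l c k long T hmin E F wit = true) {m N d : ℕ} (hm : 2 ≤ m)
    (hN : N = n + (m - 1) * bitCount long n) (hd : d = T + (m - 2) * hmin) :
    ∃ S : Subgroup (PauliGroup (Fin N)), EAStabilizes S k d c := by
  simp only [isBitEACode, Bool.and_eq_true, decide_eq_true_eq] at h
  obtain ⟨⟨⟨⟨⟨⟨⟨hn, hF⟩, hE⟩, hf⟩, hspan⟩, hwit⟩, hwit_h⟩, hwit_T⟩ := h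
  let G := (bitFrame hF).comp (blockIndex hn) (blockIndex_injective hn)
  have hweight : ∀ h w : ℕ, w + (m - 1) * h = w + h + (m - 2) * h := fun h w => by
    obtain ⟨m, rfl⟩ := Nat.exists_eq_add_of_le hm
    rw [show 2 + m - 1 = m + 1 by omega, show 2 + m - 2 = m by omega]
    ring
  have hm0 : 0 < m := by omega
  have key := G.exists_eaStabilizes_inflate (n := N) (d := d) (len := blockLength n long m)
    (by simp; omega) (fun i => ?_) (fun i => ?_) (fun i => ?_) (fun i => ?_)
    (by rw [hN, sum_blockLength n long hm0]) ?_
  · simpa using key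
  · exact cocycle_ofBits_self (by
      simpa [blockIndex] using forall_lt_of_all_range hE (i := i) (by omega))
  · exact cocycle_ofBits_self (by
      simpa [blockIndex] using forall_lt_of_all_range hE (i := l + i) (by omega))
  · exact cocycle_ofBits_self (by simpa [blockIndex] using forall_lt_of_all_range hf i.2)
  · rw [blockLength]
    split_ifs <;> omega
  · constructor
    · refine ⟨ofBits n wit, (ofBits_mem_logicals_iff hn hF).2 hwit, ?_⟩
      rw [inflatedWeight_ofBits n long hm0, hweight, hwit_T, hwit_h, hd]
    · rintro _ ⟨v, hv, rfl⟩
      have hJ : Fintype.card (Fin l ⊕ Fin c ⊕ Fin k) = Fintype.card (Fin n) := by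
        simp [hn]
      -- Coordinates are pairings with dual vectors. A logical label is orthogonal to the code
      -- vectors, so only the `e` of `L` and both vectors of the `K` pairs survive, leaving 2^(l+2k)
      -- labels to enumerate.
      have hmem : v ∈ Submodule.span (ZMod 2) (ofBits n '' {g | g ∈ (List.range l).map (bitVec E) ++
          ((List.range k).map fun i => bitVec E (l + c + i)) ++
          (List.range k).map fun i => bitVec F (l + c + i)}) := by
        rw [← G.sum_symp_smul hJ v]
        refine Submodule.sum_mem _ fun t _ => ?_
        rcases t with (i | i | i) | (i | i | i)
        · refine Submodule.smul_mem _ _ (Submodule.subset_span ⟨bitVec E i, ?_, rfl⟩)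
          simp only [List.mem_append, List.mem_map, List.mem_range]
          exact Or.inl (Or.inl ⟨i, i.2, rfl⟩)
        · rw [show symp v (G.vec (Sum.inl (.inr (.inl i))).swap) = 0 from (hv.2.1 i).2, zero_smul]
          exact Submodule.zero_mem _
        · refine Submodule.smul_mem _ _ (Submodule.subset_span ⟨bitVec E (l + c + i), ?_, rfl⟩)
          simp only [List.mem_append, List.mem_map, List.mem_range]
          exact Or.inl (Or.inr ⟨i, i.2, rfl⟩)
        · rw [show symp v (G.vec (Sum.inr (.inl i)).swap) = 0 from hv.1 i, zero_smul]
          exact Submodule.zero_mem _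
        · rw [show symp v (G.vec (Sum.inr (.inr (.inl i))).swap) = 0 from (hv.2.1 i).1, zero_smul]
          exact Submodule.zero_mem _
        · refine Submodule.smul_mem _ _ (Submodule.subset_span ⟨bitVec F (l + c + i), ?_, rfl⟩)
          simp only [List.mem_append, List.mem_map, List.mem_range]
          exact Or.inr ⟨i, i.2, rfl⟩
      obtain ⟨b, hb, hp⟩ := exists_of_forallSpan hspan hmem
      have h0 : ofBits n (0, 0) = 0 := by
        refine Prod.ext (funext fun i => ?_) (funext fun i => ?_) <;> simp [ofBits, bitZMod]
      rw [h0, add_zero] at hb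
      subst hb
      have hlog := (ofBits_mem_logicals_iff hn hF).1 hv
      rw [inflatedWeight_ofBits n long hm0, hweight, hd]
      simp only [Bool.or_eq_true, Bool.and_eq_true, decide_eq_true_eq] at hp
      rcases hp with ⟨h1, h2⟩ | h1
      · exact add_le_add h2 (Nat.mul_le_mul_left _ h1)
      -- Labels that pair trivially with all logical pairs are exempt from the bounds in the
      -- enumeration, but they are not logical.
      · exfalso
        simp only [isBitLogical, Bool.and_eq_true, List.any_eq_true] at hlog
        obtain ⟨i, hi, hi'⟩ := hlog.2
        have h3 := List.all_eq_true.1 h1 i hi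
        simp only [Bool.and_eq_true, Bool.not_eq_true'] at h3
        rw [h3.1, h3.2] at hi'
        exact Bool.noConfusion hi'

/-! #### Stabilizer codes of distance three -/

/-- The contribution of one qubit to the symplectic form. -/
def bitLocalSymp (x z : Bool) (b : ℕ × ℕ) (i : ℕ) : Bool :=
  (x && b.2.testBit i) ^^ (z && b.1.testBit i)

/-- The test whether all nonzero errors on two qubits have nonzero syndrome. -/
def detectsPairs (n l : ℕ) (E : List (ℕ × ℕ)) : Bool :=
  (List.range n).all fun i => (List.range i).all fun j =>
    [false, true].all fun x => [false, true].all fun z =>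
      [false, true].all fun x' => [false, true].all fun z' =>
        !(x || z || x' || z') || (List.range l).any fun t =>
          bitLocalSymp x z (bitVec E t) i ^^ bitLocalSymp x' z' (bitVec E t) j

theorem exists_support_pair {n : ℕ} (hn : 2 ≤ n) {v : PhaseSpace (Fin n)} (hv : weight v < 3) :
    ∃ i j : Fin n, j < i ∧ ∀ t, t ≠ i → t ≠ j → v.1 t = 0 ∧ v.2 t = 0 := by
  -- The support is enlarged to exactly two qubits, so errors of weight 0 and 1 need no separate
  -- case.
  obtain ⟨s, hs, hcard⟩ := Finset.exists_superset_card_eq (n := 2) (Nat.le_of_lt_succ hv)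
    (by rwa [Fintype.card_fin])
  have hz : ∀ t, t ∉ s → v.1 t = 0 ∧ v.2 t = 0 := fun t ht => by
    by_contra hne
    refine ht (hs (Finset.mem_filter.2 ⟨Finset.mem_univ _, ?_⟩))
    tauto
  obtain ⟨i, j, hij, rfl⟩ := Finset.card_eq_two.1 hcard
  rcases lt_or_gt_of_ne hij with h | h
  · exact ⟨j, i, h, fun t h1 h2 => hz t (by simp [h1, h2])⟩
  · exact ⟨i, j, h, fun t h1 h2 => hz t (by simp [h1, h2])⟩

theorem symp_eq_of_support_pair {n : ℕ} {v w : PhaseSpace (Fin n)} {i j : Fin n} (hij : j < i)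
    (hv : ∀ t, t ≠ i → t ≠ j → v.1 t = 0 ∧ v.2 t = 0) :
    symp v w = (v.1 i * w.2 i + v.2 i * w.1 i) + (v.1 j * w.2 j + v.2 j * w.1 j) := by
  rw [symp_apply, dotProduct, dotProduct, ← Finset.sum_add_distrib]
  refine Fintype.sum_eq_add i j hij.ne' fun t ht => ?_
  rw [(hv t ht.1 ht.2).1, (hv t ht.1 ht.2).2, zero_mul, zero_mul, add_zero]

theorem eq_zero_of_detectsPairs {n l : ℕ} (hn : 2 ≤ n) {E : List (ℕ × ℕ)}
    (h : detectsPairs n l E = true) {v : PhaseSpace (Fin n)} (hv : weight v < 3)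
    (hs : ∀ t < l, symp v (ofBits n (bitVec E t)) = 0) : v = 0 := by
  obtain ⟨i, j, hij, hsupp⟩ := exists_support_pair hn hv
  have hb : ∀ b : Bool, b ∈ [false, true] := by decide
  have h1 := forall_lt_of_all_range (forall_lt_of_all_range h i.2) hij
  have h2 := List.all_eq_true.1 (List.all_eq_true.1 (List.all_eq_true.1 (List.all_eq_true.1 h1
    (decide (v.1 i = 1)) (hb _)) (decide (v.2 i = 1)) (hb _)) (decide (v.1 j = 1)) (hb _))
    (decide (v.2 j = 1)) (hb _)
  rw [Bool.or_eq_true] at h2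
  rcases h2 with h2 | h2
  · simp only [Bool.not_eq_true', Bool.or_eq_false_iff, decide_eq_false_iff_not] at h2
    obtain ⟨⟨⟨hx, hz⟩, hx'⟩, hz'⟩ := h2
    have h01 : ∀ a : ZMod 2, a ≠ 1 → a = 0 := by decide
    refine Prod.ext (funext fun t => ?_) (funext fun t => ?_)
    · rcases eq_or_ne t i with rfl | hti
      · exact h01 _ hx
      rcases eq_or_ne t j with rfl | htj
      · exact h01 _ hx'
      exact (hsupp t hti htj).1
    · rcases eq_or_ne t i with rfl | hti
      · exact h01 _ hz
      rcases eq_or_ne t j with rfl | htj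
      · exact h01 _ hz'
      exact (hsupp t hti htj).2
  · exfalso
    obtain ⟨t, ht, ht'⟩ := List.any_eq_true.1 h2
    have h3 := hs t (List.mem_range.1 ht)
    rw [symp_eq_of_support_pair hij hsupp, ← bitZMod_decide (v.1 i), ← bitZMod_decide (v.2 i),
      ← bitZMod_decide (v.1 j), ← bitZMod_decide (v.2 j)] at h3
    simp only [ofBits, ← bitZMod_and, ← bitZMod_xor, bitZMod_eq_zero] at h3
    rw [bitLocalSymp, bitLocalSymp, h3] at ht'
    exact Bool.noConfusion ht'

/-- The numerical conditions for a stabilizer code of distance three. -/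
def isBitCode (n l k : ℕ) (E F : List (ℕ × ℕ)) (wit : ℕ × ℕ) : Bool :=
  decide (2 ≤ n) && decide (n = l + (0 + k)) && isBitFrame n E F &&
  ((List.range l).all fun i => !bitParity ((bitVec E i).1 &&& (bitVec E i).2) n) &&
  detectsPairs n l E && isBitLogical n l 0 k E F wit &&
  decide (bitCount (wit.1 ||| wit.2) n = 3)

/-- Purity spares any enumeration of the normalizer: the check excludes every nonzero label of
weight below 3 orthogonal to the stabilizer, whether logical or not. -/
theorem exists_stabilizes_of_check (n l k : ℕ) (E F : List (ℕ × ℕ)) (wit : ℕ × ℕ)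
    (h : isBitCode n l k E F wit = true) :
    ∃ S : Subgroup (PauliGroup (Fin n)), Stabilizes S k 3 := by
  simp only [isBitCode, Bool.and_eq_true, decide_eq_true_eq] at h
  obtain ⟨⟨⟨⟨⟨⟨h2, hn⟩, hF⟩, hE⟩, hpairs⟩, hwit⟩, hwit_weight⟩ := h
  let G := (bitFrame hF).comp (blockIndex hn) (blockIndex_injective hn)
  have key := G.exists_stabilizes (d := 3) (by simp; omega) (fun i => ?_) ?_
  · simpa using key
  · exact cocycle_ofBits_self (by simpa [blockIndex] using forall_lt_of_all_range hE i.2)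
  · constructor
    · exact ⟨ofBits n wit, (ofBits_mem_logicals_iff hn hF).2 hwit,
        (weight_ofBits n wit).trans hwit_weight⟩
    · rintro _ ⟨v, hv, rfl⟩
      by_contra! hlt
      have hv0 : v = 0 := eq_zero_of_detectsPairs h2 hpairs hlt fun t ht => hv.1 ⟨t, ht⟩
      subst hv0
      obtain ⟨i, hi | hi⟩ := hv.2.2
      · exact hi (by simp)
      · exact hi (by simp)

end Bits

/-! ### The codes -/

theorem exists_stabilizes_5_1_3 :
    ∃ S : Subgroup (PauliGroup (Fin 5)), Stabilizes S 1 3 :=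
  -- Each pair holds the `X` mask and the `Z` mask. The first list has the stabilizer generators
  -- followed by one half of each logical pair, the second list their symplectic partners; the last
  -- argument is a logical operator of weight 3.
  exists_stabilizes_of_check 5 4 1
    [(13, 11), (10, 5), (0, 27), (17, 29), (7, 0)]
    [(24, 0), (14, 0), (26, 0), (10, 0), (18, 1)]
    (7, 0) (by decide +kernel)

theorem exists_stabilizes_8_2_3 :
    ∃ S : Subgroup (PauliGroup (Fin 8)), Stabilizes S 2 3 :=
  exists_stabilizes_of_check 8 6 2
    [(80, 166), (121, 63), (221, 0), (68, 70), (219, 119), (200, 188), (23, 0), (124, 0)]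
    [(48, 0), (101, 0), (34, 13), (133, 0), (197, 0), (176, 0), (15, 2), (37, 5)]
    (9, 11) (by decide +kernel)

theorem exists_stabilizes_8_3_3 :
    ∃ S : Subgroup (PauliGroup (Fin 8)), Stabilizes S 3 3 :=
  exists_stabilizes_of_check 8 5 3
    [(23, 77), (7, 224), (156, 209), (174, 11), (192, 27), (14, 0), (109, 0), (196, 0)]
    [(192, 0), (32, 0), (160, 0), (120, 0), (176, 0), (49, 2), (42, 1), (35, 7)]
    (7, 6) (by decide +kernel)

theorem exists_stabilizes_10_4_3 :
    ∃ S : Subgroup (PauliGroup (Fin 10)), Stabilizes S 4 3 :=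
  exists_stabilizes_of_check 10 6 4
    [(513, 26), (812, 265), (907, 462), (306, 136), (891, 109), (231, 858), (54, 0), (153, 0),
    (472, 0), (580, 0)]
    [(528, 0), (352, 0), (608, 0), (736, 0), (32, 0), (512, 0), (75, 2), (34, 1), (168, 9),
    (367, 6)]
    (34, 1) (by decide +kernel)

theorem exists_stabilizes_11_5_3 :
    ∃ S : Subgroup (PauliGroup (Fin 11)), Stabilizes S 5 3 :=
  exists_stabilizes_of_check 11 6 5
    [(778, 1638), (1490, 303), (1003, 805), (732, 1058), (1926, 1699), (376, 827), (126, 0),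
    (213, 0), (340, 0), (984, 0), (1312, 0)]
    [(64, 0), (960, 0), (720, 0), (1216, 0), (128, 0), (16, 0), (47, 2), (34, 1), (71, 7),
    (233, 10), (412, 34)]
    (34, 1) (by decide +kernel)

theorem exists_stabilizes_12_6_3 :
    ∃ S : Subgroup (PauliGroup (Fin 12)), Stabilizes S 6 3 :=
  exists_stabilizes_of_check 12 6 6
    [(2598, 786), (1104, 2854), (2427, 47), (2752, 469), (28, 1935), (3444, 252), (22, 0),
    (73, 0), (412, 0), (632, 0), (1216, 0), (2704, 0)]
    [(3584, 0), (2048, 0), (4000, 0), (768, 0), (1024, 0), (1920, 0), (42, 2), (37, 1), (87, 6),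
    (340, 15), (437, 78), (557, 27)]
    (7, 5) (by decide +kernel)

theorem exists_stabilizes_14_8_3 :
    ∃ S : Subgroup (PauliGroup (Fin 14)), Stabilizes S 8 3 :=
  exists_stabilizes_of_check 14 6 8
    [(10443, 6683), (4229, 7734), (11880, 4692), (3475, 5616), (4205, 6628), (10813, 11102),
    (63, 0), (170, 0), (284, 0), (1000, 0), (1712, 0), (3936, 0), (4864, 0), (12928, 0)]
    [(7680, 0), (11840, 0), (4672, 0), (10816, 0), (6208, 0), (8192, 0), (23, 1), (88, 3),
    (112, 5), (165, 15), (638, 20), (560, 57), (2341, 307), (7019, 152)]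
    (0, 7) (by decide +kernel)

theorem exists_stabilizes_16_10_3 :
    ∃ S : Subgroup (PauliGroup (Fin 16)), Stabilizes S 10 3 :=
  exists_stabilizes_of_check 16 6 10
    [(51009, 32581), (7017, 53984), (51495, 57165), (29961, 51570), (27801, 46697),
    (63372, 5570), (118, 0), (209, 0), (368, 0), (836, 0), (1664, 0), (2592, 0), (6912, 0),
    (14408, 0), (23552, 0), (57344, 0)]
    [(37440, 0), (18432, 0), (35328, 0), (4160, 0), (21056, 0), (4608, 0), (13, 2), (82, 1),
    (90, 19), (435, 6), (726, 129), (603, 49), (3245, 277), (2086, 8), (15254, 1153),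
    (1062, 8200)]
    (131, 1) (by decide +kernel)

/-! ### Sender codes in infinite families. -/

theorem exists_eaStabilizes_four_mul {m : ℕ}
    (hm : 2 ≤ m) :
    ∃ S : Subgroup (PauliGroup (Fin (4 * m))), EAStabilizes S 1 (2 * m + 1) 1 :=
  -- The mask 15 lengthens the four lowest qubits, so the length is 4 + 4(m-1) = 4m, and the
  -- distance is 5 + 2(m-2) = 2m+1.
  exists_eaStabilizes_of_check 4 2 1 1 15 5 2
    [(15, 3), (15, 12), (10, 11), (3, 10)]
    [(14, 0), (4, 0), (6, 1), (9, 11)]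
    (3, 10) (by decide +kernel) hm
    (by rw [show bitCount 15 4 = 4 by decide]; omega) (by omega)

theorem exists_eaStabilizes_four_mul_add_one {m : ℕ}
    (hm : 2 ≤ m) :
    ∃ S : Subgroup (PauliGroup (Fin (4 * m + 1))), EAStabilizes S 1 (2 * m + 3) 4 :=
  -- In this and the next two families one, two and three qubits stay unreplaced; the distance is 7
  -- + 2(m-2) = 2m+3.
  exists_eaStabilizes_of_check 5 0 4 1 15 7 2
    [(3, 7), (31, 10), (0, 24), (27, 0), (25, 22)]
    [(1, 0), (6, 0), (14, 0), (1, 6), (30, 0)]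
    (25, 22) (by decide +kernel) hm
    (by rw [show bitCount 15 5 = 4 by decide]; omega) (by omega)

theorem exists_eaStabilizes_four_mul_add_two {m : ℕ}
    (hm : 2 ≤ m) :
    ∃ S : Subgroup (PauliGroup (Fin (4 * m + 2))), EAStabilizes S 1 (2 * m + 3) 3 :=
  exists_eaStabilizes_of_check 6 2 3 1 15 7 2
    [(0, 27), (42, 11), (21, 25), (10, 1), (63, 29), (31, 6)]
    [(51, 39), (24, 0), (14, 0), (41, 0), (13, 60), (41, 60)]
    (53, 13) (by decide +kernel) hm
    (by rw [show bitCount 15 6 = 4 by decide]; omega) (by omega)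

theorem exists_eaStabilizes_four_mul_add_three {m : ℕ}
    (hm : 2 ≤ m) :
    ∃ S : Subgroup (PauliGroup (Fin (4 * m + 3))), EAStabilizes S 1 (2 * m + 3) 2 :=
  exists_eaStabilizes_of_check 7 4 2 1 15 7 2
    [(112, 6), (64, 4), (32, 0), (65, 2), (97, 12), (60, 67), (123, 31)]
    [(0, 24), (7, 1), (89, 60), (62, 93), (24, 0), (122, 29), (61, 71)]
    (74, 27) (by decide +kernel) hm
    (by rw [show bitCount 15 7 = 4 by decide]; omega) (by omega)

/-! ### Sporadic sender codes. -/

theorem exists_eaStabilizes_7_2_5_5 :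
    ∃ S : Subgroup (PauliGroup (Fin 7)), EAStabilizes S 2 5 5 :=
  -- The mask 0 lengthens no qubit and makes the flip count 0, so the code is unchanged and the
  -- distance is the checked weight; `le_rfl` fixes the irrelevant m as 2.
  exists_eaStabilizes_of_check 7 0 5 2 0 5 0
    [(91, 63), (124, 39), (72, 74), (106, 61), (35, 113), (18, 59), (123, 113)]
    [(14, 0), (17, 0), (3, 108), (11, 74), (13, 12), (29, 27), (23, 102)]
    (18, 59) (by decide +kernel) le_rfl (by simp [bitCount]) rfl

theorem exists_eaStabilizes_8_2_5_4 :
    ∃ S : Subgroup (PauliGroup (Fin 8)), EAStabilizes S 2 5 4 :=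
  exists_eaStabilizes_of_check 8 2 4 2 0 5 0
    [(98, 16), (54, 201), (83, 26), (134, 104), (162, 224), (48, 254), (226, 121), (219, 173)]
    [(59, 71), (150, 7), (100, 24), (88, 26), (157, 115), (253, 26), (245, 41), (118, 110)]
    (128, 105) (by decide +kernel) le_rfl (by simp [bitCount]) rfl

theorem exists_eaStabilizes_9_3_6_6 :
    ∃ S : Subgroup (PauliGroup (Fin 9)), EAStabilizes S 3 6 6 :=
  exists_eaStabilizes_of_check 9 0 6 3 0 6 0
    [(183, 194), (184, 363), (15, 218), (346, 204), (108, 275), (398, 497), (456, 337),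
    (92, 302), (8, 493)]
    [(181, 0), (90, 0), (124, 435), (280, 0), (25, 373), (179, 488), (365, 438), (275, 99),
    (427, 33)]
    (456, 337) (by decide +kernel) le_rfl (by simp [bitCount]) rfl

theorem exists_eaStabilizes_13_3_9_10 :
    ∃ S : Subgroup (PauliGroup (Fin 13)), EAStabilizes S 3 9 10 :=
  exists_eaStabilizes_of_check 13 0 10 3 0 9 0
    [(8139, 5033), (1622, 2571), (7515, 3023), (152, 2762), (2634, 1413), (5450, 7446),
    (6824, 313), (7536, 5623), (8117, 3809), (6590, 1085), (4254, 2780), (3710, 1138),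
    (5216, 2008)]
    [(26, 0), (104, 0), (147, 0), (503, 0), (4558, 0), (828, 0), (2427, 0), (1459, 0),
    (2297, 6350), (4673, 4701), (7548, 5679), (1748, 79), (3027, 2008)]
    (4254, 2780) (by decide +kernel) le_rfl (by simp [bitCount]) rfl

theorem exists_eaStabilizes_9_2_5_3 :
    ∃ S : Subgroup (PauliGroup (Fin 9)), EAStabilizes S 2 5 3 :=
  exists_eaStabilizes_of_check 9 4 3 2 0 5 0
    [(266, 94), (283, 109), (24, 5), (84, 436), (288, 90), (393, 114), (138, 508), (119, 127),
    (445, 135)]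
    [(105, 18), (233, 11), (422, 32), (435, 85), (319, 128), (506, 90), (196, 42), (214, 471),
    (160, 90)]
    (102, 76) (by decide +kernel) le_rfl (by simp [bitCount]) rfl

theorem exists_eaStabilizes_10_2_6_4 :
    ∃ S : Subgroup (PauliGroup (Fin 10)), EAStabilizes S 2 6 4 :=
  exists_eaStabilizes_of_check 10 4 4 2 0 6 0
    [(392, 200), (547, 0), (411, 204), (335, 156), (706, 680), (718, 340), (561, 794),
    (835, 619), (88, 808), (83, 370)]
    [(330, 568), (436, 806), (565, 798), (852, 294), (171, 0), (496, 0), (98, 606), (785, 793),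
    (666, 50), (1007, 293)]
    (88, 808) (by decide +kernel) le_rfl (by simp [bitCount]) rfl

theorem exists_eaStabilizes_12_4_7_8 :
    ∃ S : Subgroup (PauliGroup (Fin 12)), EAStabilizes S 4 7 8 :=
  exists_eaStabilizes_of_check 12 0 8 4 0 7 0
    [(207, 1636), (3111, 3111), (1189, 597), (2152, 1228), (362, 2897), (2795, 2616),
    (2206, 1063), (2088, 1490), (4051, 336), (2204, 3784), (3182, 3944), (143, 2254)]
    [(88, 0), (2215, 0), (525, 0), (454, 0), (778, 3699), (1564, 3531), (1769, 3438),
    (3931, 3825), (3571, 1132), (2596, 1642), (3769, 1433), (2587, 215)]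
    (544, 1340) (by decide +kernel) le_rfl (by simp [bitCount]) rfl

/-! ### Matching senders with receivers. -/

theorem existsEAQECCNe_of_exists {n k d c m kb db : ℕ}
    (h : ∃ S : Subgroup (PauliGroup (Fin n)), EAStabilizes S k d c)
    (hb : ∃ S : Subgroup (PauliGroup (Fin m)), Stabilizes S kb db) (hc : c ≤ kb) :
    ExistsEAQECCNe n k d c m kb db := by
  obtain ⟨S, hS⟩ := h
  obtain ⟨Sb, hSb⟩ := hb
  exact ⟨S, Sb, hS, hSb, hc⟩

end QubitCode

theorem proposition4p2 :
    (∀ m : ℕ, 2 ≤ m →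
      QubitCode.ExistsEAQECCNe (4 * m) 1 (2 * m + 1) 1 5 1 3 ∧
      QubitCode.ExistsEAQECCNe (4 * m + 1) 1 (2 * m + 3) 4 10 4 3 ∧
      QubitCode.ExistsEAQECCNe (4 * m + 2) 1 (2 * m + 3) 3 8 3 3 ∧
      QubitCode.ExistsEAQECCNe (4 * m + 3) 1 (2 * m + 3) 2 8 2 3) ∧
    QubitCode.ExistsEAQECCNe 7 2 5 5 11 5 3 ∧
    QubitCode.ExistsEAQECCNe 8 2 5 4 10 4 3 ∧
    QubitCode.ExistsEAQECCNe 9 2 5 3 8 3 3 ∧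
    QubitCode.ExistsEAQECCNe 10 2 6 4 10 4 3 ∧
    QubitCode.ExistsEAQECCNe 9 3 6 6 12 6 3 ∧
    QubitCode.ExistsEAQECCNe 13 3 9 10 16 10 3 ∧
    QubitCode.ExistsEAQECCNe 12 4 7 8 14 8 3 := by
  refine ⟨fun m hm => ⟨?_, ?_, ?_, ?_⟩, ?_, ?_, ?_, ?_, ?_, ?_, ?_⟩
  · exact QubitCode.existsEAQECCNe_of_exists (QubitCode.exists_eaStabilizes_four_mul hm)
      QubitCode.exists_stabilizes_5_1_3 (by norm_num)
  · exact QubitCode.existsEAQECCNe_of_exists (QubitCode.exists_eaStabilizes_four_mul_add_one hm)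
      QubitCode.exists_stabilizes_10_4_3 (by norm_num)
  · exact QubitCode.existsEAQECCNe_of_exists (QubitCode.exists_eaStabilizes_four_mul_add_two hm)
      QubitCode.exists_stabilizes_8_3_3 (by norm_num)
  · exact QubitCode.existsEAQECCNe_of_exists (QubitCode.exists_eaStabilizes_four_mul_add_three hm)
      QubitCode.exists_stabilizes_8_2_3 (by norm_num)
  · exact QubitCode.existsEAQECCNe_of_exists QubitCode.exists_eaStabilizes_7_2_5_5
      QubitCode.exists_stabilizes_11_5_3 (by norm_num)
  · exact QubitCode.existsEAQECCNe_of_exists QubitCode.exists_eaStabilizes_8_2_5_4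
      QubitCode.exists_stabilizes_10_4_3 (by norm_num)
  · exact QubitCode.existsEAQECCNe_of_exists QubitCode.exists_eaStabilizes_9_2_5_3
      QubitCode.exists_stabilizes_8_3_3 (by norm_num)
  · exact QubitCode.existsEAQECCNe_of_exists QubitCode.exists_eaStabilizes_10_2_6_4
      QubitCode.exists_stabilizes_10_4_3 (by norm_num)
  · exact QubitCode.existsEAQECCNe_of_exists QubitCode.exists_eaStabilizes_9_3_6_6
      QubitCode.exists_stabilizes_12_6_3 (by norm_num)
  · exact QubitCode.existsEAQECCNe_of_exists QubitCode.exists_eaStabilizes_13_3_9_10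
      QubitCode.exists_stabilizes_16_10_3 (by norm_num)
  · exact QubitCode.existsEAQECCNe_of_exists QubitCode.exists_eaStabilizes_12_4_7_8
      QubitCode.exists_stabilizes_14_8_3 (by norm_num)
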